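/- **Setting.** Let $L,l:\mathbb{R}^n\to\mathbb{R}$ and $P_i:\mathbb{R}^n\to\mathbb{R}_+$ ($i=1,\dots,J$) be convex. For $r\in\mathbb{R}^J$ put $\mathcal F(r)=\{x: P_i(x)\le r_i,\ i=1,\dots,J\}$, $S_c(r)=\arg\min_{x\in\mathcal F(r)} l(x)$ and $v(r)=\inf_{x\in\mathcal F(r)} l(x)\in[-\infty,+\infty]$ (with $v(r)=+\infty$ if $\mathcal F(r)=\emptyset$). Assume that for every $r$ with all $r_i>0$ the set $\mathcal F(r)$ is nonempty and $l$ is bounded below on it. Let $\Sigma=\mathbb{R}^n\times\mathbb{R}_+^J$, $\mathcal N$ the normal cone of convex analysis, $v^*$ the Fenchel conjugate of $v$, $\delta_\Sigma$ the indicator function of $\Sigma$, and $$\mathcal M(x,r)=\Big\{\gamma\in\mathbb{R}^J_+:\ 0\in\partial l(x)+\sum_{i}\gamma_i\partial P_i(x),\ \gamma_i(P_i(x)-r_i)=0\ \forall i\Big\}.$$ Subdifferentials of the convex functions $L,l,P_i,v,\phi_k$ are those of convex analysis. The DC reformulation is $$\min_{x,\ r\in\mathbb{R}^J_+} L(x)\quad\text{s.t.}\quad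 l(x)-v(r)\le 0,\quad P_i(x)\le r_i,\ i=1,\dots,J. \tag{5}$$ A feasible point $(\bar x,\bar r)$ of (5) is a KKT stationary solution if there are $\eta\ge0$ and $\lambda\in\mathbb{R}^J_+$ with $0\in\partial L(\bar x)+\eta\,\partial l(\bar x)+\sum_i\lambda_i\partial P_i(\bar x)$, $\lambda\in-\eta\,\partial v(\bar r)+\mathcal N_{\mathbb{R}^J_+}(\bar r)$ and $\lambda_i(P_i(\bar x)-\bar r_i)=0$ for all $i$. **Algorithm (VF-iDCA).** Let $\rho,c_\alpha,\delta_\alpha,\alpha_0>0$. A run consists of infinite sequences $z^k=(x^k,r^k)\in\Sigma$, $\tilde x^k\in S_c(r^k)$, $\gamma^k\in\mathcal M(\tilde x^k,r^k)$ and $\alpha_k$ ($k\ge0$; no stopping test) such that, with $$g_k(x,r)=\max_{i=1,\dots,J}\{0,\ l(x)-l(\tilde x^k)+\langle\gamma^k,r-r^k\rangle,\ P_i(x)-r_i\},\qquad \phi_k(z)=L(x)+\tfrac{\rho}{2}\|z-z^k\|^2+\alpha_k g_k(z),$$ one has $$\mathrm{dist}\big(0,\partial\phi_k(z^{k+1})+\mathcal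 N_\Sigma(z^{k+1})\big)\le\tfrac{\sqrt2}{2}\rho\|z^k-z^{k-1}\|\quad(k\ge1),$$ and for all $k\ge0$, with $t^{k+1}=g_k(z^{k+1})$ and $\Delta^{k+1}=\|z^{k+1}-z^k\|$, $$\alpha_{k+1}=\alpha_k+\delta_\alpha\ \text{ if } \max\{\alpha_k,1/t^{k+1}\}<c_\alpha/\Delta^{k+1},\qquad \alpha_{k+1}=\alpha_k\ \text{ otherwise}$$ (division by $0$ gives $+\infty$). **Merit function.** For $z=(x,r)$, $z_0\in\mathbb{R}^n\times\mathbb{R}^J$ and $\gamma\in\mathbb{R}^J$, $$E_\alpha(z,z_0,\gamma)=L(x)+\tfrac{\rho}{4}\|z-z_0\|^2+\delta_\Sigma(z)+\alpha\max_{i=1,\dots,J}\{0,\ l(x)+\langle\gamma,r\rangle+v^*(-\gamma),\ P_i(x)-r_i\}.$$ **KL functions.** Let $\partial$ denote the limiting subdifferential. A proper lower semicontinuous $\sigma:\mathbb{R}^d\to(-\infty,+\infty]$ is a KL function if for every $\bar y$ with $\partial\sigma(\bar y)\ne\emptyset$ there are $\eta\in(0,+\infty]$, a neighbourhood $\mathcal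 Y$ of $\bar y$ and a concave continuous $\varphi:[0,\eta)\to[0,+\infty)$ with $\varphi(0)=0$, $\varphi\in C^1(0,\eta)$ and $\varphi'>0$ on $(0,\eta)$, such that $\varphi'(\sigma(y)-\sigma(\bar y))\,\mathrm{dist}(0,\partial\sigma(y))\ge1$ for all $y\in\mathcal Y$ with $\sigma(\bar y)<\sigma(y)<\sigma(\bar y)+\eta$ (where $\mathrm{dist}(0,\emptyset)=+\infty$). **Theorem.** Suppose that $L$ is bounded below, that the sequences $\{z^k\}$ and $\{\alpha_k\}$ of a run of VF-iDCA are bounded, that the merit function $E_{\bar\alpha}$ is a KL function for the value $\bar\alpha$ with $\alpha_k=\bar\alpha$ for all large $k$ (such a value exists since $\{\alpha_k\}$ is bounded), and that there is $\delta>0$ with $r^k_i\ge\delta$ for all $k$ and all $i=1,\dots,J$. Then the whole sequence $\{z^k\}$ converges to a KKT stationary solution of (5). -/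

import Mathlib

open Set Filter Topology
open scoped Pointwise ENNReal

namespace ValueFunctionDCA

noncomputable section

/-! ### Variational analysis: subdifferentials, normal cones, the KL property -/

section Variational

variable {H : Type*} [NormedAddCommGroup H] [InnerProductSpace ℝ H]

/-- The subdifferential of convex analysis of an extended-valued function. -/
def convexSubdiff (f : H → EReal) (x : H) : Set H :=
  {ξ | f x ≠ ⊤ ∧ f x ≠ ⊥ ∧ ∀ y, f x + ((inner ℝ ξ (y - x) : ℝ) : EReal) ≤ f y}

/-- The subdifferential of convex analysis of a real-valued function. -/
def realSubdiff (f : H → ℝ) (x : H) : Set H := convexSubdiff (fun y => (f y : EReal)) x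

/-- The normal cone of convex analysis (empty at points outside of the set). -/
def normalCone (C : Set H) (x : H) : Set H :=
  {ξ | x ∈ C ∧ ∀ y ∈ C, inner ℝ ξ (y - x) ≤ (0 : ℝ)}

/-- The Fréchet (regular) subdifferential. -/
def frechetSubdiff (f : H → EReal) (x : H) : Set H :=
  {ξ | f x ≠ ⊤ ∧ f x ≠ ⊥ ∧ ∀ ε : ℝ, 0 < ε →
    ∀ᶠ y in 𝓝 x, f x + ((inner ℝ ξ (y - x) - ε * ‖y - x‖ : ℝ) : EReal) ≤ f y}

/-- The limiting (Mordukhovich) subdifferential. -/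
def limitingSubdiff (f : H → EReal) (x : H) : Set H :=
  {ξ | f x ≠ ⊤ ∧ f x ≠ ⊥ ∧ ∃ (u : ℕ → H) (ζ : ℕ → H),
    (∀ m, ζ m ∈ frechetSubdiff f (u m)) ∧ Tendsto u atTop (𝓝 x) ∧
      Tendsto (fun m => f (u m)) atTop (𝓝 (f x)) ∧ Tendsto ζ atTop (𝓝 ξ)}

/-- The class `Φ_η` of desingularizing functions on `[0, η)`, where `η ∈ (0, +∞]`. -/
structure IsDesingularizing (η : EReal) (φ : ℝ → ℝ) : Prop where
  concave : ConcaveOn ℝ {s : ℝ | 0 ≤ s ∧ (s : EReal) < η} φ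
  continuous : ContinuousOn φ {s : ℝ | 0 ≤ s ∧ (s : EReal) < η}
  nonneg : ∀ s : ℝ, 0 ≤ s → (s : EReal) < η → 0 ≤ φ s
  map_zero : φ 0 = 0
  contDiff : ContDiffOn ℝ 1 φ {s : ℝ | 0 < s ∧ (s : EReal) < η}
  deriv_pos : ∀ s : ℝ, 0 < s → (s : EReal) < η → 0 < deriv φ s

/-- The Kurdyka–Łojasiewicz property at a point.  The distance to the empty set is `+∞`. -/
def HasKLAt (σ : H → EReal) (ybar : H) : Prop :=
  ∃ η : EReal, 0 < η ∧ ∃ Y ∈ 𝓝 ybar, ∃ φ : ℝ → ℝ, IsDesingularizing η φ ∧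
    ∀ y ∈ Y, σ ybar < σ y → σ y < σ ybar + η →
      1 ≤ ENNReal.ofReal (deriv φ (σ y - σ ybar).toReal) *
        Metric.infEDist 0 (limitingSubdiff σ y)

/-- A KL function: proper, lower semicontinuous, with the KL property on `dom ∂σ`. -/
structure IsKLFunction (σ : H → EReal) : Prop where
  ne_bot : ∀ y, σ y ≠ ⊥
  exists_ne_top : ∃ y, σ y ≠ ⊤
  lsc : LowerSemicontinuous σ
  kl : ∀ y, (limitingSubdiff σ y).Nonempty → HasKLAt σ y

/-- The indicator function of convex analysis: `0` on `C`, `+∞` outside. -/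
def indicatorFn (C : Set H) (x : H) : EReal :=
  ⨅ _ : x ∈ C, (0 : EReal)

/-- The Fenchel conjugate `f*(ξ) = sup_r {⟨ξ, r⟩ - f(r)}`. -/
def conjugate (f : H → EReal) (ξ : H) : EReal :=
  ⨆ r, (((inner ℝ ξ r : ℝ) : EReal) - f r)

end Variational

/-! ### The bilevel problem -/

/-- `ℝᵈ` with its Euclidean norm. -/
abbrev Vec (d : ℕ) := EuclideanSpace ℝ (Fin d)

/-- Pairs `z = (x, r) ∈ ℝⁿ × ℝᴶ`, with the Euclidean norm; `x = z.fst`, `r = z.snd`. -/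
abbrev Pt (n J : ℕ) := WithLp 2 (Vec n × Vec J)

/-- Triples `(z, z₀, γ)`, with the Euclidean norm. -/
abbrev Triple (n J : ℕ) := WithLp 2 (Pt n J × WithLp 2 (Pt n J × Vec J))

/-- The nonnegative orthant `ℝ₊ᴶ`. -/
def orthant (J : ℕ) : Set (Vec J) := {r | ∀ i, 0 ≤ r i}

/-- `Σ = ℝⁿ × ℝ₊ᴶ`. -/
def sigmaSet (n J : ℕ) : Set (Pt n J) := {z | z.snd ∈ orthant J}

section Problem

variable {n J : ℕ}

/-- The lower-level feasible set `F(r) = {x | P_i(x) ≤ r_i for all i}`. -/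
def feasible (P : Fin J → Vec n → ℝ) (r : Vec J) : Set (Vec n) :=
  {x | ∀ i, P i x ≤ r i}

/-- The solution set `S_c(r)` of the constrained lower-level problem. -/
def solutionSet (l : Vec n → ℝ) (P : Fin J → Vec n → ℝ) (r : Vec J) : Set (Vec n) :=
  {x | x ∈ feasible P r ∧ ∀ y ∈ feasible P r, l x ≤ l y}

/-- The lower-level value function `v(r)`, equal to `+∞` where `F(r)` is empty. -/
def valueFn (l : Vec n → ℝ) (P : Fin J → Vec n → ℝ) (r : Vec J) : EReal :=
  ⨅ x ∈ feasible P r, (l x : EReal)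

/-- The set `M(x, r)` of KKT multipliers of the lower-level problem. -/
def multipliers (l : Vec n → ℝ) (P : Fin J → Vec n → ℝ) (x : Vec n) (r : Vec J) :
    Set (Vec J) :=
  {γ | γ ∈ orthant J ∧ (0 : Vec n) ∈ realSubdiff l x + ∑ i, γ i • realSubdiff (P i) x ∧
    ∀ i, γ i * (P i x - r i) = 0}

/-- KKT stationary solutions of `min L(x)` over `x`, `r ≥ 0` subject to `l(x) - v(r) ≤ 0` and
`P_i(x) ≤ r_i`. -/
def IsKKTStationary (L l : Vec n → ℝ) (P : Fin J → Vec n → ℝ) (z : Pt n J) : Prop :=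
  z ∈ sigmaSet n J ∧ (l z.fst : EReal) ≤ valueFn l P z.snd ∧ (∀ i, P i z.fst ≤ z.snd i) ∧
    ∃ (η : ℝ) (lam : Vec J), 0 ≤ η ∧ lam ∈ orthant J ∧
      (0 : Vec n) ∈ realSubdiff L z.fst + η • realSubdiff l z.fst
        + ∑ i, lam i • realSubdiff (P i) z.fst ∧
      lam ∈ (-η) • convexSubdiff (valueFn l P) z.snd + normalCone (orthant J) z.snd ∧
      ∀ i, lam i * (P i z.fst - z.snd i) = 0

/-! ### The algorithm and the merit function -/

/-- `max_i {0, V(x, r), P_i(x) - r_i}` with `V(x, r) = l(x) - l(xt) + ⟨γ, r - rk⟩`, where `rk` is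
the current `r`-iterate, `xt` a lower-level solution at `rk` and `γ` a multiplier.
(For `J = 0` the last supremum is `0`, which does not change the maximum.) -/
def linGap (l : Vec n → ℝ) (P : Fin J → Vec n → ℝ) (rk : Vec J) (xt : Vec n) (γ : Vec J)
    (z : Pt n J) : ℝ :=
  max (max 0 (l z.fst - l xt + inner ℝ γ (z.snd - rk))) (⨆ i, (P i z.fst - z.snd i))

/-- The objective `φ_k` of the subproblem at `zk`, with proximal parameter `ρ` and penalty `a`. -/
def subObjective (L l : Vec n → ℝ) (P : Fin J → Vec n → ℝ) (ρ a : ℝ) (zk : Pt n J)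
    (xt : Vec n) (γ : Vec J) (z : Pt n J) : ℝ :=
  L z.fst + ρ / 2 * ‖z - zk‖ ^ 2 + a * linGap l P zk.snd xt γ z

/-- `(z, xt, γ, α)` is an (infinite) run of VF-iDCA with parameters `ρ, c, d`: iterates `z k`,
lower-level solutions `xt k`, multipliers `γ k` and penalties `α k`.
The inexactness criterion refers to two earlier iterates, so it is imposed for `k ≥ 1` (it is
written with `k + 1` for `k`); the first step only has to stay in `Σ`.
In the penalty update, quotients are taken in `[0, +∞]`, where `1 / 0 = c / 0 = +∞`. -/
structure IsVFiDCARun (L l : Vec n → ℝ) (P : Fin J → Vec n → ℝ) (ρ c d : ℝ)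
    (z : ℕ → Pt n J) (xt : ℕ → Vec n) (γ : ℕ → Vec J) (α : ℕ → ℝ) : Prop where
  mem_sigma : ∀ k, z k ∈ sigmaSet n J
  penalty_pos : 0 < α 0
  lower_solution : ∀ k, xt k ∈ solutionSet l P (z k).snd
  multiplier : ∀ k, γ k ∈ multipliers l P (xt k) (z k).snd
  inexact : ∀ k,
    Metric.infEDist 0
      (realSubdiff (subObjective L l P ρ (α (k + 1)) (z (k + 1)) (xt (k + 1)) (γ (k + 1)))
          (z (k + 2))
        + normalCone (sigmaSet n J) (z (k + 2)))
      ≤ ENNReal.ofReal (√2 / 2 * ρ * ‖z (k + 1) - z k‖)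
  penalty_update : ∀ k, α (k + 1) =
    if max (ENNReal.ofReal (α k))
        (1 / ENNReal.ofReal (linGap l P (z k).snd (xt k) (γ k) (z (k + 1))))
        < ENNReal.ofReal c / ENNReal.ofReal ‖z (k + 1) - z k‖
    then α k + d else α k

/-- The merit function
`E_a(z, z₀, γ) = L(x) + (ρ/4) ‖z - z₀‖² + δ_Σ(z)
  + a max_i {0, l(x) + ⟨γ, r⟩ + v*(-γ), P_i(x) - r_i}`. -/
def merit (L l : Vec n → ℝ) (P : Fin J → Vec n → ℝ) (ρ a : ℝ) (w : Triple n J) : EReal :=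
  let z := w.fst
  let z₀ := w.snd.fst
  let γ := w.snd.snd
  ((L z.fst + ρ / 4 * ‖z - z₀‖ ^ 2 : ℝ) : EReal) + indicatorFn (sigmaSet n J) z
    + (a : EReal) *
      max (max 0 (((l z.fst + inner ℝ γ z.snd : ℝ) : EReal) + conjugate (valueFn l P) (-γ)))
        (⨆ i, ((P i z.fst - z.snd i : ℝ) : EReal))

end Problem

end

end ValueFunctionDCA

open ValueFunctionDCA

namespace ValueFunctionDCA

/-! ### Convex analysis -/

section Convex

/-! Attouch–Bolte style convergence: sufficient decrease, a relative error bound and the KL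
inequality give a summable step length, and the limit inherits the optimality systems of the
subproblems.

A KKT multiplier `γ k` gives `-γ k ∈ ∂v(r^k)` (`multipliers_lower_bound`). By Fenchel–Young equality
the term `l + ⟨γ, r⟩ + v*(-γ)` of the merit function is then exactly the linearised gap of the
subproblem, so the merit function can be evaluated along the run. Replacing one linearisation of `v`
by the next does not increase the gap at the current iterate, and the proximal term outweighs the
inexactness (`meritValue_succ_le`). Bounding `v*` below by an affine function that touches it at `-γ
k` gives regular subgradients of size O(step) (`exists_mem_frechetSubdiff_merit`), although `v*`
need not be smooth.

Bounded penalties are eventually constant. Once they are, the update rule bounds the gap by a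
multiple of the step (`linGap_le`), so limit points are feasible for the DC reformulation. Since
`r^k ≥ δ`, a Slater-type estimate bounds the multipliers. The triples `(z^{k+1}, z^k, γ^k)`
therefore stay in a compact set and have critical cluster points with a common merit value. Gluing
KL inequalities over that set and telescoping (`summable_of_slopeBound`) makes `z` a Cauchy
sequence.

For stationarity, `exists_multipliers` turns each approximate subproblem solution into a Lagrangian
inequality with bounded multipliers. In the limit, `r ≥ δ > 0` leaves no normal-cone contribution in
`r` and forces `λ = η γ`, where `-γ ∈ ∂v`. -/

/-- The sandwich theorem: between a concave function on a convex set and a continuous convex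
function above it there is a continuous affine function. -/
theorem exists_affine_between {E : Type*} [NormedAddCommGroup E] [NormedSpace ℝ E]
    {f h : E → ℝ} {S : Set E} (hf : ConvexOn ℝ univ f) (hfc : Continuous f)
    (hh : ConcaveOn ℝ S h) (hS : S.Nonempty) (hle : ∀ x ∈ S, h x ≤ f x) :
    ∃ (F : E →L[ℝ] ℝ) (c : ℝ), (∀ x, F x + c ≤ f x) ∧ ∀ x ∈ S, h x ≤ F x + c := by
  have hA : Convex ℝ {p : E × ℝ | p.1 ∈ univ ∧ f p.1 < p.2} := hf.convex_strict_epigraph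
  have hB : Convex ℝ {p : E × ℝ | p.1 ∈ S ∧ p.2 ≤ h p.1} := hh.convex_hypograph
  have hAo : IsOpen {p : E × ℝ | p.1 ∈ univ ∧ f p.1 < p.2} := by
    simp only [mem_univ, true_and]
    exact isOpen_lt (hfc.comp continuous_fst) continuous_snd
  have hdisj : Disjoint {p : E × ℝ | p.1 ∈ univ ∧ f p.1 < p.2} {p : E × ℝ | p.1 ∈ S ∧ p.2 ≤ h p.1} := by
    rw [Set.disjoint_left]
    rintro ⟨x, t⟩ ⟨-, h1⟩ ⟨h2, h3⟩
    exact absurd (h3.trans (hle x h2)) (not_le.2 h1)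
  obtain ⟨G, u, hGA, hGB⟩ := geometric_hahn_banach_open hA hAo hB hdisj
  have hsplit : ∀ (x : E) (t : ℝ), G (x, t) = G (x, 0) + t * G (0, 1) := fun x t => by
    have : ((x, t) : E × ℝ) = (x, 0) + t • (0, 1) := by simp
    rw [this, map_add, map_smul, smul_eq_mul]
  obtain ⟨x0, hx0⟩ := hS
  -- The separating hyperplane is not vertical: over `x0` lie both an epigraph point and a lower
  -- hypograph point.
  have hb : G (0, 1) < 0 := by
    have h1 := hGA (x0, f x0 + 1) ⟨mem_univ _, by simp⟩
    have h2 := hGB (x0, h x0) ⟨hx0, le_rfl⟩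
    rw [hsplit] at h1 h2
    have := hle x0 hx0
    by_contra hcon
    push Not at hcon
    nlinarith
  have hFa : ∀ x, ((-(G (0, 1))⁻¹) • G.comp (ContinuousLinearMap.inl ℝ E ℝ)) x + u * (G (0, 1))⁻¹
      = (u - G (x, 0)) / G (0, 1) := fun x => by
    simp
    ring
  refine ⟨(-(G (0, 1))⁻¹) • G.comp (ContinuousLinearMap.inl ℝ E ℝ), u * (G (0, 1))⁻¹,
    fun x => ?_, fun x hx => ?_⟩
  · rw [hFa, div_le_iff_of_neg hb]
    refine le_of_forall_pos_lt_add fun ε hε => ?_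
    have h1 := hGA (x, f x + ε / (-G (0, 1))) ⟨mem_univ _, by
      simpa using div_pos hε (neg_pos.2 hb)⟩
    rw [hsplit] at h1
    have : ε / (-G (0, 1)) * G (0, 1) = -ε := by field_simp [hb.ne]
    nlinarith
  · rw [hFa, le_div_iff_of_neg hb]
    have h2 := hGB (x, h x) ⟨hx, le_rfl⟩
    rw [hsplit] at h2
    linarith

theorem ConvexOn.continuous_of_finiteDimensional {E : Type*} [NormedAddCommGroup E]
    [NormedSpace ℝ E] [FiniteDimensional ℝ E] {f : E → ℝ} (hf : ConvexOn ℝ univ f) :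
    Continuous f :=
  continuousOn_univ.1 (hf.continuousOn isOpen_univ)

theorem convexOn_sum_const_mul {E ι : Type*} [AddCommGroup E] [Module ℝ E] (s : Finset ι)
    {f : ι → E → ℝ} {c : ι → ℝ} (hf : ∀ i, ConvexOn ℝ univ (f i)) (hc : ∀ i, 0 ≤ c i) :
    ConvexOn ℝ univ (fun y => ∑ i ∈ s, c i * f i y) := by
  classical
  induction s using Finset.induction_on with
  | empty => simpa using convexOn_const (0 : ℝ) (convex_univ : Convex ℝ (univ : Set E))
  | insert i s hi ih =>
    simp only [Finset.sum_insert hi]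
    exact ((hf i).smul (hc i)).add ih

/-- A quadratic error term can be dropped from a subgradient inequality of a convex function. -/
theorem subgradient_of_sub_quadratic {E : Type*} [NormedAddCommGroup E] [NormedSpace ℝ E]
    {f : E → ℝ} {C : Set E} (hf : ConvexOn ℝ C f) {x : E} (hx : x ∈ C) {F : E →ₗ[ℝ] ℝ} {K : ℝ}
    (h : ∀ y ∈ C, f x + F (y - x) - K * ‖y - x‖ ^ 2 ≤ f y) {y : E} (hy : y ∈ C) :
    f x + F (y - x) ≤ f y := by
  -- Testing at `x + t(y - x)` and dividing by `t` leaves an error of order `t`.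
  have key : ∀ t ∈ Ioc (0 : ℝ) 1, f x + F (y - x) - t * (K * ‖y - x‖ ^ 2) ≤ f y := by
    rintro t ⟨ht0, ht1⟩
    have hmem : (1 - t) • x + t • y ∈ C := hf.1 hx hy (by linarith) ht0.le (by ring)
    have h1 := h _ hmem
    have h2 := hf.2 hx hy (sub_nonneg.2 ht1) ht0.le (by ring)
    have h3 : (1 - t) • x + t • y - x = t • (y - x) := by module
    rw [h3, map_smul, norm_smul, mul_pow, Real.norm_eq_abs, sq_abs] at h1
    simp only [smul_eq_mul] at h1 h2
    have : t * (f x + F (y - x) - t * (K * ‖y - x‖ ^ 2)) ≤ t * f y := by nlinarith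
    exact le_of_mul_le_mul_left this ht0
  have hlim : Tendsto (fun t : ℝ => f x + F (y - x) - t * (K * ‖y - x‖ ^ 2)) (𝓝[>] 0)
      (𝓝 (f x + F (y - x) - 0 * (K * ‖y - x‖ ^ 2))) :=
    ((continuous_const.sub (continuous_id.mul continuous_const)).tendsto 0).mono_left
      nhdsWithin_le_nhds
  rw [zero_mul, sub_zero] at hlim
  refine le_of_tendsto hlim ?_
  filter_upwards [Ioc_mem_nhdsGT (zero_lt_one' ℝ)] with t ht using key t ht

end Convex

/-! ### Subdifferential calculus for finite convex functions. -/

section Subdiff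

variable {H : Type*} [NormedAddCommGroup H] [InnerProductSpace ℝ H]

theorem mem_realSubdiff {f : H → ℝ} {x ξ : H} :
    ξ ∈ realSubdiff f x ↔ ∀ y, f x + inner ℝ ξ (y - x) ≤ f y := by
  simp only [realSubdiff, convexSubdiff, mem_ofPred_eq, ne_eq, EReal.coe_ne_top, not_false_eq_true,
    EReal.coe_ne_bot, true_and]
  refine forall_congr' fun y => ?_
  rw [← EReal.coe_add, EReal.coe_le_coe_iff]

variable [FiniteDimensional ℝ H]

/-- The Moreau–Rockafellar sum rule. -/
theorem realSubdiff_add_subset {f g : H → ℝ} (hf : ConvexOn ℝ univ f) (hg : ConvexOn ℝ univ g)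
    (x : H) : realSubdiff (f + g) x ⊆ realSubdiff f x + realSubdiff g x := by
  intro ξ hξ
  rw [mem_realSubdiff] at hξ
  have hc : ConcaveOn ℝ univ (fun y => (f x + g x) + inner ℝ ξ (y - x) - g y) := by
    refine ConcaveOn.sub ?_ hg
    refine ⟨convex_univ, fun y _ w _ a b _ _ hab => le_of_eq ?_⟩
    simp only [smul_eq_mul, inner_sub_right, inner_add_right, inner_smul_right]
    have : b = 1 - a := by linarith
    subst this
    ring
  obtain ⟨F, c, h1, h2⟩ := exists_affine_between hf hf.continuous_of_finiteDimensional hc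
    ⟨x, mem_univ x⟩ (fun y _ => by have := hξ y; simp only [Pi.add_apply] at this; linarith)
  have hx : f x = F x + c := le_antisymm (by simpa using h2 x (mem_univ x)) (h1 x)
  have hF : ∀ y, inner ℝ ((InnerProductSpace.toDual ℝ H).symm F) y = F y := fun y =>
    InnerProductSpace.toDual_symm_apply
  refine ⟨(InnerProductSpace.toDual ℝ H).symm F, mem_realSubdiff.2 fun y => ?_,
    ξ - (InnerProductSpace.toDual ℝ H).symm F, mem_realSubdiff.2 fun y => ?_, by simp⟩
  · rw [hF, map_sub]
    linarith [h1 y]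
  · rw [inner_sub_left, hF, map_sub]
    linarith [h2 y (mem_univ y)]

/-- Covers zero coefficients in the sum rule: `0 • ∅ = ∅`, so `0 ∈ 0 • ∂f` requires a nonempty
subdifferential. The sandwich theorem is applied over a single point. -/
theorem realSubdiff_nonempty {f : H → ℝ} (hf : ConvexOn ℝ univ f) (x : H) :
    (realSubdiff f x).Nonempty := by
  obtain ⟨F, c, h1, h2⟩ := exists_affine_between hf hf.continuous_of_finiteDimensional
    (S := {x}) (h := f) ⟨convex_singleton x, by
      rintro y rfl w rfl a b _ _ hab
      rw [← add_smul, ← add_smul, hab, one_smul, one_smul]⟩ ⟨x, rfl⟩ (fun y _ => le_rfl)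
  refine ⟨(InnerProductSpace.toDual ℝ H).symm F, mem_realSubdiff.2 fun y => ?_⟩
  rw [InnerProductSpace.toDual_symm_apply, map_sub]
  linarith [h1 y, h2 x rfl]

theorem realSubdiff_const_mul_subset {f : H → ℝ} (hf : ConvexOn ℝ univ f) {c : ℝ} (hc : 0 ≤ c)
    (x : H) : realSubdiff (fun y => c * f y) x ⊆ c • realSubdiff f x := by
  intro ξ hξ
  rw [mem_realSubdiff] at hξ
  rcases hc.eq_or_lt with rfl | hc
  · have h := hξ (x + ξ)
    simp only [zero_mul, zero_add, add_sub_cancel_left, real_inner_self_eq_norm_sq] at h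
    have : ξ = 0 := by
      have := le_antisymm h (sq_nonneg _)
      simpa using this
    rw [this, zero_smul_set (realSubdiff_nonempty hf x)]
    rfl
  · rw [mem_smul_set_iff_inv_smul_mem₀ hc.ne']
    refine mem_realSubdiff.2 fun y => ?_
    rw [real_inner_smul_left]
    have := hξ y
    have h2 : c * (f x + c⁻¹ * inner ℝ ξ (y - x)) ≤ c * f y := by
      rw [mul_add, mul_inv_cancel_left₀ hc.ne']
      exact this
    exact le_of_mul_le_mul_left h2 hc

theorem realSubdiff_sum_subset {ι : Type*} (s : Finset ι) {f : ι → H → ℝ} {c : ι → ℝ}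
    (hf : ∀ i, ConvexOn ℝ univ (f i)) (hc : ∀ i, 0 ≤ c i) (x : H) :
    realSubdiff (fun y => ∑ i ∈ s, c i * f i y) x ⊆ ∑ i ∈ s, c i • realSubdiff (f i) x := by
  classical
  induction s using Finset.induction_on with
  | empty =>
    intro ξ hξ
    have h := mem_realSubdiff.1 hξ (x + ξ)
    simp only [Finset.sum_empty, zero_add, add_sub_cancel_left, real_inner_self_eq_norm_sq] at h
    have := le_antisymm h (sq_nonneg _)
    simpa using this
  | insert i s hi ih =>
    simp only [Finset.sum_insert hi]
    have h1 : ConvexOn ℝ univ (fun y => c i * f i y) := (hf i).smul (hc i)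
    exact (realSubdiff_add_subset h1 (convexOn_sum_const_mul s hf hc) x).trans
      (add_subset_add (realSubdiff_const_mul_subset (hf i) (hc i) x) ih)

end Subdiff

end ValueFunctionDCA

namespace ValueFunctionDCA

noncomputable section

/-! ### The maximum of zero, a number and finitely many numbers -/

section PosMax

variable {J : ℕ}

/-- `max {0, a, b₁, …, b_J}`. -/
def posMax (a : ℝ) (b : Fin J → ℝ) : ℝ := max (max 0 a) (⨆ i, b i)

theorem posMax_le_iff {a t : ℝ} {b : Fin J → ℝ} :
    posMax a b ≤ t ↔ 0 ≤ t ∧ a ≤ t ∧ ∀ i, b i ≤ t := by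
  unfold posMax
  rw [max_le_iff, max_le_iff, and_assoc]
  constructor
  · rintro ⟨h0, ha, hb⟩
    exact ⟨h0, ha, fun i => (le_ciSup (finite_range b).bddAbove i).trans hb⟩
  · rintro ⟨h0, ha, hb⟩
    exact ⟨h0, ha, Real.iSup_le hb h0⟩

theorem posMax_nonneg (a : ℝ) (b : Fin J → ℝ) : 0 ≤ posMax a b := (posMax_le_iff.1 le_rfl).1

theorem le_posMax_left (a : ℝ) (b : Fin J → ℝ) : a ≤ posMax a b := (posMax_le_iff.1 le_rfl).2.1

theorem le_posMax_right (a : ℝ) (b : Fin J → ℝ) (i : Fin J) : b i ≤ posMax a b :=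
  (posMax_le_iff.1 le_rfl).2.2 i

theorem posMax_mono {a a' : ℝ} {b b' : Fin J → ℝ} (ha : a ≤ a') (hb : ∀ i, b i ≤ b' i) :
    posMax a b ≤ posMax a' b' :=
  posMax_le_iff.2 ⟨posMax_nonneg _ _, ha.trans (le_posMax_left _ _),
    fun i => (hb i).trans (le_posMax_right _ _ i)⟩

theorem convexOn_posMax {E : Type*} [AddCommGroup E] [Module ℝ E] {f : E → ℝ}
    {g : Fin J → E → ℝ} (hf : ConvexOn ℝ univ f) (hg : ∀ i, ConvexOn ℝ univ (g i)) :
    ConvexOn ℝ univ (fun x => posMax (f x) (fun i => g i x)) := by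
  refine ⟨convex_univ, fun x _ y _ a b ha hb hab => ?_⟩
  have hcomb : ∀ {u v u' v' : ℝ}, u ≤ u' → v ≤ v' → a • u + b • v ≤ a • u' + b • v' :=
    fun h1 h2 => add_le_add (mul_le_mul_of_nonneg_left h1 ha) (mul_le_mul_of_nonneg_left h2 hb)
  exact posMax_le_iff.2 ⟨add_nonneg (mul_nonneg ha (posMax_nonneg _ _))
      (mul_nonneg hb (posMax_nonneg _ _)),
    (hf.2 trivial trivial ha hb hab).trans (hcomb (le_posMax_left _ _) (le_posMax_left _ _)),
    fun i => ((hg i).2 trivial trivial ha hb hab).trans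
      (hcomb (le_posMax_right _ (fun i => g i x) i) (le_posMax_right _ (fun i => g i y) i))⟩

end PosMax

/-! ### Multipliers for penalised maxima -/

/-- A subgradient of `f + c max {0, a, b₁, …, b_J}` extends to a subgradient of the function
obtained by perturbing the entries of the maximum. -/
theorem exists_multipliers {J : ℕ} {H : Type*} [NormedAddCommGroup H] [InnerProductSpace ℝ H]
    [FiniteDimensional ℝ H] {f a : H → ℝ} {b : Fin J → H → ℝ} {c : ℝ} (hc : 0 ≤ c)
    (hf : ConvexOn ℝ univ f) (ha : ConvexOn ℝ univ a) (hb : ∀ i, ConvexOn ℝ univ (b i))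
    {x ξ : H} (hξ : ξ ∈ realSubdiff (fun y => f y + c * posMax (a y) fun i => b i y) x) :
    ∃ (μ : ℝ) (lam : Fin J → ℝ), 0 ≤ μ ∧ μ ≤ c ∧ (∀ i, 0 ≤ lam i) ∧ (∀ i, lam i ≤ c) ∧
      (∀ i, b i x < 0 → lam i = 0) ∧
      ∀ y (s : ℝ) (t : Fin J → ℝ),
        f x + c * posMax (a x) (fun i => b i x) + inner ℝ ξ (y - x) + μ * s + ∑ i, lam i * t i
          ≤ f y + c * posMax (a y + s) (fun i => b i y + t i) := by
  rw [mem_realSubdiff] at hξ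
  let Φ : H × ℝ × (Fin J → ℝ) → ℝ := fun p =>
    f p.1 + c * posMax (a p.1 + p.2.1) (fun i => b i p.1 + p.2.2 i)
  have hfst : ∀ {g : H → ℝ}, ConvexOn ℝ univ g →
      ConvexOn ℝ univ (fun p : H × ℝ × (Fin J → ℝ) => g p.1) := fun hg =>
    hg.comp_linearMap (LinearMap.fst ℝ H (ℝ × (Fin J → ℝ)))
  have hΦ : ConvexOn ℝ univ Φ := by
    refine (hfst hf).add (ConvexOn.smul hc (convexOn_posMax ((hfst ha).add ?_)
      fun i => (hfst (hb i)).add ?_))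
    · exact ⟨convex_univ, fun p _ q _ u v _ _ _ => le_of_eq (by simp)⟩
    · exact ⟨convex_univ, fun p _ q _ u v _ _ _ => le_of_eq (by simp)⟩
  have hS : Convex ℝ {p : H × ℝ × (Fin J → ℝ) | p.2 = 0} := by
    intro p hp q hq u v _ _ _
    simp only [mem_ofPred_eq] at hp hq ⊢
    simp [hp, hq]
  -- The subgradient inequality says that this affine function lies below `Φ` on the subspace of
  -- zero perturbations. A sandwiched affine function extends it to all perturbations, and its
  -- slopes in `s` and `t` are the multipliers.
  have hh : ConcaveOn ℝ {p : H × ℝ × (Fin J → ℝ) | p.2 = 0}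
      (fun p => Φ (x, 0) + inner ℝ ξ (p.1 - x)) := by
    refine ⟨hS, fun p _ q _ u v _ _ huv => le_of_eq ?_⟩
    obtain rfl : v = 1 - u := by linarith
    simp only [smul_eq_mul, inner_sub_right, Prod.fst_add, Prod.smul_fst, inner_add_right,
      inner_smul_right]
    ring
  have hΦx : Φ (x, 0) = f x + c * posMax (a x) (fun i => b i x) := by simp [Φ]
  obtain ⟨F, k, h1, h2⟩ := exists_affine_between hΦ hΦ.continuous_of_finiteDimensional hh
    ⟨(x, 0), rfl⟩ (by
      rintro ⟨y, p⟩ rfl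
      have := hξ y
      rw [hΦx]
      simpa [Φ] using this)
  have hk : Φ (x, 0) = F (x, 0) + k :=
    le_antisymm (by simpa using h2 (x, 0) rfl) (h1 (x, 0))
  have hlin : ∀ y, F (y, 0) = inner ℝ ξ y := by
    have hge : ∀ y, inner ℝ ξ y ≤ F (y, 0) := fun y => by
      have h3 := h2 (x + y, 0) rfl
      have h4 : F (x + y, 0) = F (x, 0) + F (y, 0) := by rw [← map_add]; simp
      simp only [add_sub_cancel_left] at h3
      linarith
    intro y
    refine le_antisymm ?_ (hge y)
    have h3 := hge (-y)
    have h4 : F (-y, 0) = -F (y, 0) := by rw [← map_neg]; simp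
    rw [inner_neg_right] at h3
    linarith
  have hdec : ∀ (y : H) (s : ℝ) (t : Fin J → ℝ), F (y, s, t) =
      inner ℝ ξ y + F (0, 1, 0) * s + ∑ i, F (0, 0, Pi.single i 1) * t i := fun y s t => by
    have : (y, s, t) = (y, 0) + s • ((0 : H), (1 : ℝ), (0 : Fin J → ℝ))
        + ∑ i, t i • ((0 : H), (0 : ℝ), (Pi.single i 1 : Fin J → ℝ)) := by
      ext j
      · simp [Prod.fst_sum]
      · simp [Prod.snd_sum, Prod.fst_sum]
      · simp [Prod.snd_sum, Finset.sum_apply, Pi.single_apply]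
    rw [this, map_add, map_add, hlin, map_sum]
    simp only [map_smul, smul_eq_mul]
    simp only [mul_comm]
  have main : ∀ y (s : ℝ) (t : Fin J → ℝ),
      f x + c * posMax (a x) (fun i => b i x) + inner ℝ ξ (y - x) + F (0, 1, 0) * s
        + ∑ i, F (0, 0, Pi.single i 1) * t i
          ≤ f y + c * posMax (a y + s) (fun i => b i y + t i) := fun y s t => by
    have h3 := h1 (y, s, t)
    rw [hdec] at h3
    rw [hlin] at hk
    rw [inner_sub_right, ← hΦx]
    have h4 : Φ (y, s, t) = f y + c * posMax (a y + s) (fun i => b i y + t i) := rfl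
    linarith
  have main0 : ∀ (s : ℝ) (t : Fin J → ℝ), c * posMax (a x) (fun i => b i x) + F (0, 1, 0) * s
        + ∑ i, F (0, 0, Pi.single i 1) * t i ≤ c * posMax (a x + s) (fun i => b i x + t i) :=
    fun s t => by
      have := main x s t
      rw [sub_self, inner_zero_right] at this
      linarith
  have hsingle : ∀ (i : Fin J) (u : ℝ), ∑ j, F (0, 0, Pi.single j 1) * (Pi.single i u : Fin J → ℝ) j
      = F (0, 0, Pi.single i 1) * u := fun i u => by
    simp [Pi.single_apply]
  have hone : ∀ (s : ℝ) (t : Fin J → ℝ), s ≤ 1 → (∀ i, t i ≤ 1) →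
      posMax (a x + s) (fun i => b i x + t i) ≤ posMax (a x) (fun i => b i x) + 1 :=
    fun s t hs ht => posMax_le_iff.2
      ⟨add_nonneg (posMax_nonneg _ _) zero_le_one, add_le_add (le_posMax_left _ _) hs,
        fun i => add_le_add (le_posMax_right _ (fun i => b i x) i) (ht i)⟩
  have hsle : ∀ (i j : Fin J) (u : ℝ), u ≤ 1 → (Pi.single i u : Fin J → ℝ) j ≤ 1 := fun i j u hu => by
    rw [Pi.single_apply]; split_ifs <;> simp [hu]
  -- Sign and size of the multipliers: lowering one entry cannot raise the maximum, and raising it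
  -- by 1 raises the maximum by at most 1.
  have hnn : ∀ i, 0 ≤ F (0, 0, Pi.single i 1) := fun i => by
    have h3 := main0 0 (Pi.single i (-1))
    rw [hsingle] at h3
    have h4 : posMax (a x + 0) (fun j => b j x + (Pi.single i (-1) : Fin J → ℝ) j)
        ≤ posMax (a x) fun i => b i x :=
      posMax_mono (by linarith) (fun j => by
        rw [Pi.single_apply]; split_ifs <;> linarith)
    have h5 := mul_le_mul_of_nonneg_left h4 hc
    linarith
  refine ⟨F (0, 1, 0), fun i => F (0, 0, Pi.single i 1), ?_, ?_, hnn, fun i => ?_,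
    fun i hi => ?_, main⟩
  · have h3 := main0 (-1) 0
    have h4 : posMax (a x + -1) (fun i => b i x + (0 : Fin J → ℝ) i) ≤ posMax (a x) fun i => b i x :=
      posMax_mono (by linarith) (by simp)
    have h5 := mul_le_mul_of_nonneg_left h4 hc
    simp only [Pi.zero_apply, mul_zero, Finset.sum_const_zero] at h3 h5
    linarith
  · have h3 := main0 1 0
    have h5 := mul_le_mul_of_nonneg_left (hone 1 0 le_rfl (by simp)) hc
    simp only [Pi.zero_apply, mul_zero, Finset.sum_const_zero] at h3 h5
    linarith
  · have h3 := main0 0 (Pi.single i 1)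
    rw [hsingle] at h3
    have h5 := mul_le_mul_of_nonneg_left
      (hone 0 (Pi.single i 1) zero_le_one (fun j => hsle i j 1 le_rfl)) hc
    linarith
  -- A negative entry can be raised to 0 without changing the maximum, which already contains 0.
  · have h3 := main0 0 (Pi.single i (-b i x))
    rw [hsingle] at h3
    have h4 : posMax (a x + 0) (fun j => b j x + (Pi.single i (-b i x) : Fin J → ℝ) j)
        ≤ posMax (a x) fun i => b i x := by
      refine posMax_le_iff.2 ⟨posMax_nonneg _ _, by simpa using le_posMax_left _ _, fun j => ?_⟩
      rw [Pi.single_apply]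
      split_ifs with hj
      · subst hj; simpa using posMax_nonneg _ _
      · simpa using le_posMax_right (a x) (fun i => b i x) j
    have h5 := mul_le_mul_of_nonneg_left h4 hc
    have h6 : F (0, 0, Pi.single i 1) * (-b i x) ≤ 0 := by linarith
    nlinarith [hnn i]

end

end ValueFunctionDCA

namespace ValueFunctionDCA

/-! ### The Kurdyka–Łojasiewicz argument -/

section KL

/-- `φ` is nonnegative on `[0, η)` and `ψ ≥ 0` bounds its backward slopes from below, as the
derivative of a nondecreasing concave function does. -/
structure HasSlopeBound (η : ℝ) (φ ψ : ℝ → ℝ) : Prop where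
  nonneg : ∀ s, 0 ≤ s → s < η → 0 ≤ φ s
  slope_nonneg : ∀ s, 0 < s → s < η → 0 ≤ ψ s
  slope_le : ∀ s t, 0 ≤ t → t < s → s < η → ψ s * (s - t) ≤ φ s - φ t

theorem HasSlopeBound.mono {η η' : ℝ} {φ ψ : ℝ → ℝ} (h : HasSlopeBound η φ ψ) (hη : η' ≤ η) :
    HasSlopeBound η' φ ψ :=
  ⟨fun s h0 h1 => h.nonneg s h0 (h1.trans_le hη), fun s h0 h1 => h.slope_nonneg s h0 (h1.trans_le hη),
    fun s t h0 h1 h2 => h.slope_le s t h0 h1 (h2.trans_le hη)⟩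

/-- Sums glue the finitely many local KL inequalities of a compact cover. Unlike desingularizing
functions, this class also contains zero, used on patches that the sequence eventually avoids. -/
theorem HasSlopeBound.add {η : ℝ} {φ ψ φ' ψ' : ℝ → ℝ} (h : HasSlopeBound η φ ψ)
    (h' : HasSlopeBound η φ' ψ') : HasSlopeBound η (φ + φ') (ψ + ψ') :=
  ⟨fun s h0 h1 => add_nonneg (h.nonneg s h0 h1) (h'.nonneg s h0 h1),
    fun s h0 h1 => add_nonneg (h.slope_nonneg s h0 h1) (h'.slope_nonneg s h0 h1),
    fun s t h0 h1 h2 => by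
      have := h.slope_le s t h0 h1 h2
      have := h'.slope_le s t h0 h1 h2
      simp only [Pi.add_apply]
      linarith⟩

theorem IsDesingularizing.hasSlopeBound {η : EReal} {η' : ℝ} {φ : ℝ → ℝ}
    (h : IsDesingularizing η φ) (hη : (η' : EReal) ≤ η) : HasSlopeBound η' φ (deriv φ) := by
  have hlt : ∀ {s : ℝ}, s < η' → (s : EReal) < η := fun hs =>
    (EReal.coe_lt_coe_iff.2 hs).trans_le hη
  refine ⟨fun s h0 h1 => h.nonneg s h0 (hlt h1), fun s h0 h1 => (h.deriv_pos s h0 (hlt h1)).le,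
    fun s t ht hts hs => ?_⟩
  have hs0 := ht.trans_lt hts
  -- `deriv` is 0 where the function is not differentiable, so positivity supplies
  -- differentiability.
  have hd := h.deriv_pos s hs0 (hlt hs)
  have := h.concave.deriv_le_slope (x := t) (y := s) ⟨ht, hlt (hts.trans hs)⟩ ⟨hs0.le, hlt hs⟩ hts
    (differentiableAt_of_deriv_ne_zero hd.ne')
  rwa [slope_def_field, le_div_iff₀ (sub_pos.2 hts)] at this

variable {H : Type*} [NormedAddCommGroup H] [InnerProductSpace ℝ H]

theorem HasKLAt.exists_hasSlopeBound {σ : H → EReal} {w : H} (h : HasKLAt σ w) :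
    ∃ η : ℝ, 0 < η ∧ ∃ Y ∈ 𝓝 w, ∃ φ ψ, HasSlopeBound η φ ψ ∧
      ∀ y ∈ Y, ∀ e' e : ℝ, σ w = e' → σ y = e → e' < e → e < e' + η →
        ∀ ζ ∈ limitingSubdiff σ y, 1 ≤ ψ (e - e') * ‖ζ‖ := by
  obtain ⟨η, hη, Y, hY, φ, hφ, hKL⟩ := h
  obtain ⟨η', h0, h1⟩ := EReal.lt_iff_exists_real_btwn.1 hη
  have h0' : 0 < η' := EReal.coe_pos.1 h0
  have hb := hφ.hasSlopeBound h1.le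
  refine ⟨η', h0', Y, hY, φ, deriv φ, hb, ?_⟩
  intro y hy e' e he' he hlt hlt' ζ hζ
  have h2 := hKL y hy (by rw [he, he']; exact_mod_cast hlt) (by
    rw [he, he']
    refine (EReal.coe_lt_coe_iff.2 hlt').trans_le ?_
    rw [EReal.coe_add]
    exact add_le_add le_rfl h1.le)
  rw [he, he', ← EReal.coe_sub, EReal.toReal_coe] at h2
  have h3 : Metric.infEDist 0 (limitingSubdiff σ y) ≤ ENNReal.ofReal ‖ζ‖ := by
    refine (Metric.infEDist_le_edist_of_mem hζ).trans_eq ?_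
    rw [edist_dist, dist_zero_left]
  have h4 := h2.trans (mul_le_mul_right h3 _)
  rw [← ENNReal.ofReal_mul (hb.slope_nonneg _ (by linarith) (by linarith)),
    ENNReal.one_le_ofReal] at h4
  exact h4

/-- The uniformised KL property along a relatively compact sequence. -/
theorem exists_uniform_slopeBound {σ : H → EReal} {K : Set H} (hK : IsCompact K) {w : ℕ → H}
    (hw : ∀ k, w k ∈ K) {e : ℕ → ℝ} (he : ∀ k, σ (w k) = e k) {e' : ℝ}
    (hcl : ∀ y, MapClusterPt y atTop w → σ y = e' ∧ HasKLAt σ y) :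
    ∃ η : ℝ, 0 < η ∧ ∃ φ ψ, HasSlopeBound η φ ψ ∧
      ∀ᶠ k in atTop, e' < e k → e k < e' + η →
        ∀ ζ ∈ limitingSubdiff σ (w k), 1 ≤ ψ (e k - e') * ‖ζ‖ := by
  suffices h : ∃ η : ℝ, 0 < η ∧ ∃ φ ψ, HasSlopeBound η φ ψ ∧
      ∀ᶠ k in atTop, w k ∈ K → e' < e k → e k < e' + η →
        ∀ ζ ∈ limitingSubdiff σ (w k), 1 ≤ ψ (e k - e') * ‖ζ‖ by
    obtain ⟨η, h0, φ, ψ, h1, h2⟩ := h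
    exact ⟨η, h0, φ, ψ, h1, h2.mono fun k hk => hk (hw k)⟩
  -- Compactness induction on the set in which `w k` lies for large `k`. Unions add the functions;
  -- near a cluster point the local KL property applies; a neighbourhood of any other point is
  -- eventually avoided.
  refine hK.induction_on (p := fun S => ∃ η : ℝ, 0 < η ∧ ∃ φ ψ, HasSlopeBound η φ ψ ∧
      ∀ᶠ k in atTop, w k ∈ S → e' < e k → e k < e' + η →
        ∀ ζ ∈ limitingSubdiff σ (w k), 1 ≤ ψ (e k - e') * ‖ζ‖) ?_ ?_ ?_ ?_
  · exact ⟨1, one_pos, 0, 0, ⟨fun _ _ _ => le_rfl, fun _ _ _ => le_rfl, by simp⟩, by simp⟩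
  · rintro s t hst ⟨η, h0, φ, ψ, h1, h2⟩
    exact ⟨η, h0, φ, ψ, h1, h2.mono fun k hk hks => hk (hst hks)⟩
  · rintro s t ⟨η, h0, φ, ψ, h1, h2⟩ ⟨η', h0', φ', ψ', h1', h2'⟩
    refine ⟨min η η', lt_min h0 h0', φ + φ', ψ + ψ',
      (h1.mono (min_le_left _ _)).add (h1'.mono (min_le_right _ _)), ?_⟩
    filter_upwards [h2, h2'] with k hk hk' hmem hlt hlt' ζ hζ
    have hl : e k < e' + η := hlt'.trans_le (by gcongr; exact min_le_left _ _)
    have hl' : e k < e' + η' := hlt'.trans_le (by gcongr; exact min_le_right _ _)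
    have hn := mul_nonneg (h1.slope_nonneg (e k - e') (by linarith) (by linarith)) (norm_nonneg ζ)
    have hn' := mul_nonneg (h1'.slope_nonneg (e k - e') (by linarith) (by linarith)) (norm_nonneg ζ)
    rw [Pi.add_apply, add_mul]
    rcases hmem with hm | hm
    · linarith [hk hm hlt hl ζ hζ]
    · linarith [hk' hm hlt hl' ζ hζ]
  · intro y _
    by_cases hy : MapClusterPt y atTop w
    · obtain ⟨hσ, hKL⟩ := hcl y hy
      obtain ⟨η, h0, Y, hY, φ, ψ, h1, h2⟩ := hKL.exists_hasSlopeBound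
      exact ⟨Y, mem_nhdsWithin_of_mem_nhds hY, η, h0, φ, ψ, h1, Eventually.of_forall
        fun k hk hlt hlt' => h2 _ hk e' (e k) hσ (he k) hlt hlt'⟩
    · rw [mapClusterPt_iff_frequently] at hy
      push Not at hy
      obtain ⟨Y, hY, hev⟩ := hy
      exact ⟨Y, mem_nhdsWithin_of_mem_nhds hY, 1, one_pos, 0, 0,
        ⟨fun _ _ _ => le_rfl, fun _ _ _ => le_rfl, by simp⟩,
        hev.mono fun k hk hk' => absurd hk' hk⟩

/-- Sufficient decrease and a KL inequality imply finite length. -/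
theorem summable_of_slopeBound {D e : ℕ → ℝ} {a b e' η : ℝ} {φ ψ : ℝ → ℝ} (ha : 0 < a) (hb : 0 ≤ b)
    (hD : ∀ k, 0 ≤ D k) (hdec : ∀ k, a * D (k + 2) ^ 2 ≤ e k - e (k + 1))
    (hlim : Tendsto e atTop (𝓝 e')) (hη : 0 < η) (hφ : HasSlopeBound η φ ψ)
    (hKL : ∀ᶠ k in atTop, e' < e k → e k < e' + η →
      1 ≤ ψ (e k - e') * (b * (D k + D (k + 1)))) : Summable D := by
  have hanti : Antitone e := antitone_nat_of_succ_le fun k => by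
    have := mul_nonneg ha.le (sq_nonneg (D (k + 2)))
    linarith [hdec k]
  have hge : ∀ k, e' ≤ e k := fun k => hanti.le_of_tendsto hlim k
  obtain ⟨N, hN⟩ := eventually_atTop.1 (hKL.and (hlim.eventually_lt_const (lt_add_of_pos_right e' hη)))
  -- If the limit value is attained, monotonicity freezes `e` and all later steps vanish.
  by_cases hex : ∃ k, e k = e'
  · obtain ⟨m, hm⟩ := hex
    refine (summable_nat_add_iff (m + 2)).1 ?_
    have hzero : ∀ k, D (k + (m + 2)) = 0 := fun k => by
      have h1 : e (k + m) ≤ e' := hm ▸ hanti (Nat.le_add_left m k)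
      have h2 := hdec (k + m)
      have h3 := hge (k + m + 1)
      have h4 : D (k + m + 2) ^ 2 ≤ 0 := by
        by_contra hcon
        push Not at hcon
        have := mul_pos ha hcon
        linarith
      exact pow_eq_zero_iff two_ne_zero |>.1 (le_antisymm h4 (sq_nonneg _))
    simp only [hzero]
    exact summable_zero
  · push Not at hex
    have hgt : ∀ k, e' < e k := fun k => lt_of_le_of_ne (hge k) (Ne.symm (hex k))
    have hstep : ∀ k, N ≤ k → D (k + 2) ≤ (D k + D (k + 1)) / 4
        + b / a * (φ (e k - e') - φ (e (k + 1) - e')) := by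
      intro k hk
      obtain ⟨h1, h2⟩ := hN k hk
      have h1 := h1 (hgt k) h2
      have hψ := hφ.slope_nonneg (e k - e') (by linarith [hgt k]) (by linarith)
      have hsl : ψ (e k - e') * (e k - e (k + 1)) ≤ φ (e k - e') - φ (e (k + 1) - e') := by
        rcases (hanti (Nat.le_succ k)).eq_or_lt with heq | hlt
        · rw [Nat.succ_eq_add_one] at heq
          simp [heq]
        · have := hφ.slope_le (e k - e') (e (k + 1) - e') (by linarith [hge (k + 1)])
            (by linarith [hlt]) (by linarith)
          simpa using this
      set X := D k + D (k + 1) with hX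
      have hX0 : 0 ≤ X := add_nonneg (hD _) (hD _)
      set δ := φ (e k - e') - φ (e (k + 1) - e')
      have hδ0 : 0 ≤ δ := le_trans (mul_nonneg hψ (by linarith [hanti (Nat.le_succ k)])) hsl
      have h3 : a * D (k + 2) ^ 2 ≤ b * X * δ := by
        have hbX : 0 ≤ b * X := mul_nonneg hb hX0
        calc a * D (k + 2) ^ 2 ≤ (a * D (k + 2) ^ 2) * (ψ (e k - e') * (b * X)) :=
              le_mul_of_one_le_right (mul_nonneg ha.le (sq_nonneg _)) h1
          _ = (b * X) * (ψ (e k - e') * (a * D (k + 2) ^ 2)) := by ring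
          _ ≤ (b * X) * (ψ (e k - e') * (e k - e (k + 1))) := by
              gcongr
              exact hdec k
          _ ≤ b * X * δ := by gcongr
      have h4 : D (k + 2) ^ 2 ≤ X * (b / a * δ) := by
        have : X * (b / a * δ) = b * X * δ / a := by ring
        rw [this, le_div_iff₀ ha]
        linarith
      have h5 : 0 ≤ b / a * δ := mul_nonneg (div_nonneg hb ha.le) hδ0
      refine abs_le_of_sq_le_sq' ?_ (by positivity) |>.2
      -- AM–GM in the form `XY ≤ (X/4 + Y)²`. The weight 1/4 gives the two earlier steps total
      -- weight 1/2 < 1, so they can be absorbed.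
      nlinarith [sq_nonneg (X / 4 - b / a * δ)]
    -- The weights are chosen so that `hstep` reads `D (k + 2) ≤ 2 (V k - V (k + 1))`.
    let V : ℕ → ℝ := fun k => D (k + 1) / 2 + D k / 4 + b / a * φ (e k - e')
    have hV : ∀ k, N ≤ k → 0 ≤ V k := fun k hk => by
      have := hφ.nonneg (e k - e') (by linarith [hge k]) (by linarith [(hN k hk).2])
      have := hD k
      have := hD (k + 1)
      positivity
    refine (summable_nat_add_iff (N + 2)).1
      (summable_of_sum_range_le (c := 2 * V N) (fun k => hD _) fun m => ?_)
    have key : ∑ k ∈ Finset.range m, D (k + (N + 2)) ≤ 2 * (V N - V (m + N)) := by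
      induction m with
      | zero => simp
      | succ m ih =>
        rw [Finset.sum_range_succ]
        have := hstep (m + N) (Nat.le_add_left _ _)
        have h1 : V (m + 1 + N) = D (m + N + 2) / 2 + D (m + N + 1) / 4
            + b / a * φ (e (m + N + 1) - e') := by
          simp only [V]
          rw [show m + 1 + N = m + N + 1 by ring]
        have h2 : V (m + N) = D (m + N + 1) / 2 + D (m + N) / 4 + b / a * φ (e (m + N) - e') := rfl
        rw [← add_assoc m N 2]
        rw [h1]
        rw [h2] at ih
        linarith
    linarith [hV (m + N) (Nat.le_add_left _ _)]

end KL

end ValueFunctionDCA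

namespace ValueFunctionDCA

noncomputable section

/-! ### The value function and its conjugate -/

section ValueFunction

variable {n J : ℕ} {l : Vec n → ℝ} {P : Fin J → Vec n → ℝ}

theorem inner_eq_sum_mul (u v : Vec J) : inner ℝ u v = ∑ i, u i * v i := by
  rw [PiLp.inner_apply]
  exact Finset.sum_congr rfl fun i _ => by simp [mul_comm]

/-- Add the subgradient inequalities of `l` and of the `γ i • P i`; complementarity replaces `γ i *
P i x` by `γ i * r i`. When `v(r) = l x`, this is `-γ ∈ ∂v(r)`. -/
theorem multipliers_lower_bound {x : Vec n} {r γ : Vec J} (h : γ ∈ multipliers l P x r)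
    (r' : Vec J) {y : Vec n} (hy : y ∈ feasible P r') : l x - inner ℝ γ (r' - r) ≤ l y := by
  obtain ⟨hγ, ⟨ξ, hξ, s, hs, hsum⟩, hcomp⟩ := h
  obtain ⟨g, hg, rfl⟩ := (Set.mem_finsetSum _ _ _).1 hs
  have hi : ∀ i, inner ℝ (g i) (y - x) ≤ γ i * (r' - r) i := fun i => by
    obtain ⟨u, hu, hgu⟩ := hg (Finset.mem_univ i)
    have hgu : γ i • u = g i := hgu
    have h1 := mem_realSubdiff.1 hu y
    have h2 := hy i
    have h3 := hcomp i
    have h4 : γ i * (P i x + inner ℝ u (y - x)) ≤ γ i * r' i :=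
      mul_le_mul_of_nonneg_left (h1.trans h2) (hγ i)
    rw [← hgu, real_inner_smul_left, PiLp.sub_apply]
    linarith
  have h1 := mem_realSubdiff.1 hξ y
  have h2 : ξ = -∑ i, g i := eq_neg_of_add_eq_zero_left hsum
  rw [h2, inner_neg_left, sum_inner] at h1
  rw [inner_eq_sum_mul]
  linarith [Finset.sum_le_sum fun i (_ : i ∈ Finset.univ) => hi i]

theorem valueFn_eq_of_mem_solutionSet {r : Vec J} {x : Vec n} (hx : x ∈ solutionSet l P r) :
    valueFn l P r = l x :=
  le_antisymm (iInf₂_le x hx.1) (le_iInf₂ fun y hy => EReal.coe_le_coe_iff.2 (hx.2 y hy))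

/-- Fenchel–Young equality: for `-γ ∈ ∂v(r)` the supremum defining `v*(-γ)` is attained at `r`. -/
theorem conjugate_valueFn_eq {r γ : Vec J} {v : ℝ} (hv : valueFn l P r = v)
    (h : ∀ r' y, y ∈ feasible P r' → v - inner ℝ γ (r' - r) ≤ l y) :
    conjugate (valueFn l P) (-γ) = ((-inner ℝ γ r - v : ℝ) : EReal) := by
  refine le_antisymm (iSup_le fun r' => ?_) ?_
  · have h1 : ((v - inner ℝ γ (r' - r) : ℝ) : EReal) ≤ valueFn l P r' :=
      le_iInf₂ fun y hy => EReal.coe_le_coe_iff.2 (h r' y hy)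
    refine (EReal.sub_le_sub le_rfl h1).trans ?_
    rw [← EReal.coe_sub, EReal.coe_le_coe_iff, inner_neg_left, inner_sub_right]
    linarith
  · refine le_trans ?_ (le_iSup _ r)
    rw [hv, ← EReal.coe_sub, inner_neg_left]

end ValueFunction

/-! ### The merit function -/

section Merit

variable {n J : ℕ} {L l : Vec n → ℝ} {P : Fin J → Vec n → ℝ} {ρ a : ℝ}

/-- For `J = 0` the real supremum is 0 and the extended one is `⊥`; the entry 0 of the maximum
absorbs both. -/
theorem coe_posMax (s : ℝ) (b : Fin J → ℝ) :
    ((posMax s b : ℝ) : EReal) = max (max 0 (s : EReal)) (⨆ i, (b i : EReal)) := by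
  refine le_antisymm ?_ ?_
  · rcases le_total (max 0 s) (⨆ i, b i) with h | h
    · rcases isEmpty_or_nonempty (Fin J) with hJ | hJ
      · have : posMax s b = 0 := by
          rw [Real.iSup_of_isEmpty] at h
          exact le_antisymm (posMax_le_iff.2 ⟨le_rfl, (le_max_right _ _).trans h,
            fun i => hJ.elim i⟩) (posMax_nonneg _ _)
        rw [this]
        exact le_max_of_le_left (le_max_left _ _)
      · obtain ⟨i, hi⟩ := exists_eq_ciSup_of_finite (f := b)
        have : posMax s b = b i := by rw [posMax, max_eq_right h, ← hi]
        rw [this]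
        exact le_max_of_le_right (le_iSup (fun i => (b i : EReal)) i)
    · have : posMax s b = max 0 s := max_eq_left h
      rw [this, EReal.coe_strictMono.monotone.map_max, EReal.coe_zero]
      exact le_max_left _ _
  · refine max_le (max_le ?_ ?_) (iSup_le fun i => ?_)
    · exact_mod_cast posMax_nonneg s b
    · exact_mod_cast le_posMax_left s b
    · exact_mod_cast le_posMax_right s b i

/-- The triple `(z, z₀, γ)` as a point of the Euclidean product. -/
def mkTriple (z z₀ : Pt n J) (γ : Vec J) : Triple n J := WithLp.toLp 2 (z, WithLp.toLp 2 (z₀, γ))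

theorem inner_mkTriple (u v : Pt n J) (g : Vec J) (d : Triple n J) :
    inner ℝ (mkTriple u v g) d = inner ℝ u d.fst + (inner ℝ v d.snd.fst + inner ℝ g d.snd.snd) :=
  (WithLp.prod_inner_apply (mkTriple u v g) d).trans
    (congrArg (inner ℝ u d.fst + ·) (WithLp.prod_inner_apply (mkTriple u v g).snd d.snd))

theorem norm_sq_mkTriple (u v : Pt n J) (g : Vec J) :
    ‖mkTriple u v g‖ ^ 2 = ‖u‖ ^ 2 + (‖v‖ ^ 2 + ‖g‖ ^ 2) :=
  (WithLp.prod_norm_sq_eq_of_L2 (mkTriple u v g)).trans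
    (congrArg (‖u‖ ^ 2 + ·) (WithLp.prod_norm_sq_eq_of_L2 (mkTriple u v g).snd))

theorem merit_eq_of_conjugate_eq {w : Triple n J} (hw : w.fst ∈ sigmaSet n J) {c : ℝ}
    (hc : conjugate (valueFn l P) (-w.snd.snd) = c) :
    merit L l P ρ a w = ((L w.fst.fst + ρ / 4 * ‖w.fst - w.snd.fst‖ ^ 2
      + a * posMax (l w.fst.fst + inner ℝ w.snd.snd w.fst.snd + c)
        (fun i => P i w.fst.fst - w.fst.snd i) : ℝ) : EReal) := by
  simp only [merit, indicatorFn, hc, hw, iInf_pos, add_zero]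
  rw [EReal.coe_add _ (a * _), EReal.coe_mul, coe_posMax, EReal.coe_add _ c]

theorem merit_ge_of_le_conjugate (ha : 0 ≤ a) {w : Triple n J} {c : ℝ}
    (hc : c ≤ conjugate (valueFn l P) (-w.snd.snd)) (hw : w.fst ∈ sigmaSet n J) :
    ((L w.fst.fst + ρ / 4 * ‖w.fst - w.snd.fst‖ ^ 2
      + a * posMax (l w.fst.fst + inner ℝ w.snd.snd w.fst.snd + c)
        (fun i => P i w.fst.fst - w.fst.snd i) : ℝ) : EReal) ≤ merit L l P ρ a w := by
  simp only [merit, indicatorFn, hw, iInf_pos, add_zero]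
  rw [EReal.coe_add _ (a * _), EReal.coe_mul, coe_posMax, EReal.coe_add _ c]
  refine add_le_add le_rfl (mul_le_mul_of_nonneg_left ?_ (EReal.coe_nonneg.2 ha))
  exact max_le_max (max_le_max le_rfl (add_le_add le_rfl hc)) le_rfl

theorem merit_eq_top_of_notMem (ha : 0 ≤ a) {w : Triple n J} (hw : w.fst ∉ sigmaSet n J) :
    merit L l P ρ a w = ⊤ := by
  simp only [merit, indicatorFn, hw, not_false_eq_true, iInf_neg]
  rw [EReal.coe_add_top]
  refine EReal.top_add_of_ne_bot (ne_bot_of_le_ne_bot (b := 0) EReal.zero_ne_bot ?_)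
  exact mul_nonneg (EReal.coe_nonneg.2 ha) (le_max_of_le_left (le_max_left _ _))

theorem convexOn_comp_fst {f : Vec n → ℝ} (hf : ConvexOn ℝ univ f) :
    ConvexOn ℝ univ (fun z : Pt n J => f z.fst) :=
  ⟨convex_univ, fun z _ w _ _ _ hs ht hst => hf.2 (mem_univ z.fst) (mem_univ w.fst) hs ht hst⟩

theorem convexOn_gap (hl : ConvexOn ℝ univ l) (r : Vec J) (x : Vec n) (γ : Vec J) :
    ConvexOn ℝ univ (fun z : Pt n J => l z.fst - l x + inner ℝ γ (z.snd - r)) := by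
  refine ((convexOn_comp_fst hl).sub (concaveOn_const _ convex_univ)).add
    ⟨convex_univ, fun z _ w _ s t _ _ hst => le_of_eq ?_⟩
  obtain rfl : t = 1 - s := by linarith
  simp only [WithLp.add_snd, WithLp.smul_snd, inner_sub_right, inner_add_right, inner_smul_right,
    smul_eq_mul]
  ring

theorem convexOn_constraint (hP : ∀ i, ConvexOn ℝ univ (P i)) (i : Fin J) :
    ConvexOn ℝ univ (fun z : Pt n J => P i z.fst - z.snd i) := by
  refine (convexOn_comp_fst (hP i)).sub
    ⟨convex_univ, fun z _ w _ s t _ _ hst => le_of_eq ?_⟩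
  simp

theorem convexOn_penalized (hL : ConvexOn ℝ univ L) (hl : ConvexOn ℝ univ l)
    (hP : ∀ i, ConvexOn ℝ univ (P i)) (ha : 0 ≤ a) (r : Vec J) (x : Vec n) (γ : Vec J) :
    ConvexOn ℝ univ (fun z : Pt n J => L z.fst + a * linGap l P r x γ z) :=
  (convexOn_comp_fst hL).add
    (ConvexOn.smul ha (convexOn_posMax (convexOn_gap hl r x γ) (convexOn_constraint hP)))

/-- The proximal term can be moved out of a subgradient of the subproblem. -/
theorem sub_smul_mem_realSubdiff_penalized (hL : ConvexOn ℝ univ L) (hl : ConvexOn ℝ univ l)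
    (hP : ∀ i, ConvexOn ℝ univ (P i)) (ha : 0 ≤ a) {zk zb : Pt n J} {x : Vec n}
    {γ : Vec J} {ξ : Pt n J} (hξ : ξ ∈ realSubdiff (subObjective L l P ρ a zk x γ) zb) :
    ξ - ρ • (zb - zk) ∈ realSubdiff (fun z => L z.fst + a * linGap l P zk.snd x γ z) zb := by
  rw [mem_realSubdiff] at hξ ⊢
  intro y
  refine subgradient_of_sub_quadratic (F := (innerSL ℝ (ξ - ρ • (zb - zk))).toLinearMap)
    (K := ρ / 2) (convexOn_penalized hL hl hP ha zk.snd x γ) (mem_univ zb) (fun y _ => ?_)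
    (mem_univ y)
  have h := hξ y
  have h1 : ‖y - zk‖ ^ 2 = ‖y - zb‖ ^ 2 + 2 * inner ℝ (zb - zk) (y - zb) + ‖zb - zk‖ ^ 2 := by
    rw [show y - zk = (y - zb) + (zb - zk) by abel, norm_add_sq_real, real_inner_comm]
  simp only [subObjective, h1] at h
  simp only [ContinuousLinearMap.coe_coe, innerSL_apply_apply]
  rw [inner_sub_left ξ, real_inner_smul_left]
  linarith

/-- Regular subgradients of the merit function from the optimality system of a subproblem. -/
theorem exists_mem_frechetSubdiff_merit (hL : ConvexOn ℝ univ L) (hl : ConvexOn ℝ univ l)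
    (hP : ∀ i, ConvexOn ℝ univ (P i)) (hρ : 0 ≤ ρ) (ha : 0 ≤ a) {zk zb : Pt n J} {x : Vec n}
    {γ : Vec J} (hx : valueFn l P zk.snd = l x)
    (hγ : ∀ r' y, y ∈ feasible P r' → l x - inner ℝ γ (r' - zk.snd) ≤ l y)
    {ξ₁ ξ₂ : Pt n J} (h₁ : ξ₁ ∈ realSubdiff (subObjective L l P ρ a zk x γ) zb)
    (h₂ : ξ₂ ∈ normalCone (sigmaSet n J) zb) :
    ∃ ζ ∈ frechetSubdiff (merit L l P ρ a) (mkTriple zb zk γ),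
      ‖ζ‖ ≤ ‖ξ₁ + ξ₂‖ + (ρ + a) * ‖zb - zk‖ := by
  obtain ⟨μ, lam, hμ0, hμ, -, -, -, hsub⟩ := exists_multipliers (f := fun z : Pt n J => L z.fst) ha
    (convexOn_comp_fst hL) (convexOn_gap hl zk.snd x γ) (convexOn_constraint hP)
    (sub_smul_mem_realSubdiff_penalized hL hl hP ha h₁)
  have hconj := conjugate_valueFn_eq hx hγ
  have hm := merit_eq_of_conjugate_eq (L := L) (ρ := ρ) (a := a) (w := mkTriple zb zk γ) h₂.1 hconj
  -- One term of the supremum gives a minorant of `v*(-γ')` affine in `γ'`, exact at `γ' = γ`.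
  have hge : ∀ γ' : Vec J, ((-inner ℝ γ' zk.snd - l x : ℝ) : EReal) ≤
      conjugate (valueFn l P) (-γ') := fun γ' => by
    refine le_trans ?_ (le_iSup _ zk.snd)
    rw [hx, ← EReal.coe_sub, inner_neg_left]
  -- Removing the subproblem gradient `ρ(zb - zk)` and adding the merit gradient `(ρ/2)(zb - zk)`
  -- gives the first entry. The second is the `z₀`-gradient, and the third is `μ` times the
  -- `γ`-derivative of `⟨γ, r - rk⟩`.
  refine ⟨mkTriple (ξ₁ + ξ₂ - (ρ / 2) • (zb - zk)) (-((ρ / 2) • (zb - zk))) (μ • (zb.snd - zk.snd)),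
    ⟨by rw [hm]; exact EReal.coe_ne_top _, by rw [hm]; exact EReal.coe_ne_bot _,
      fun ε hε => ?_⟩, ?_⟩
  · have hball : ∀ᶠ y in 𝓝 (mkTriple zb zk γ), ‖y - mkTriple zb zk γ‖ < ε / (μ + 1) := by
      have := Metric.ball_mem_nhds (mkTriple zb zk γ) (show 0 < ε / (μ + 1) by positivity)
      filter_upwards [this] with y hy
      rwa [mem_ball_iff_norm] at hy
    filter_upwards [hball] with y hy
    by_cases hyS : y.fst ∈ sigmaSet n J
    swap
    · rw [merit_eq_top_of_notMem ha hyS]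
      exact le_top
    refine le_trans ?_ (merit_ge_of_le_conjugate ha (hge y.snd.snd) hyS)
    rw [hm, ← EReal.coe_add, EReal.coe_le_coe_iff]
    set d := y - mkTriple zb zk γ with hd
    have hI : inner ℝ (mkTriple (ξ₁ + ξ₂ - (ρ / 2) • (zb - zk)) (-((ρ / 2) • (zb - zk)))
        (μ • (zb.snd - zk.snd))) d = inner ℝ (ξ₁ - ρ • (zb - zk)) (y.fst - zb)
          + inner ℝ ξ₂ (y.fst - zb) + ρ / 2 * inner ℝ (zb - zk) (y.fst - y.snd.fst - (zb - zk))
          + μ * inner ℝ (y.snd.snd - γ) (zb.snd - zk.snd) := by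
      have d1 : d.fst = y.fst - zb := rfl
      have d2 : d.snd.fst = (y.fst - zb) - (y.fst - y.snd.fst - (zb - zk)) := by
        rw [show d.snd.fst = y.snd.fst - zk from rfl]
        abel
      have d3 : d.snd.snd = y.snd.snd - γ := rfl
      rw [inner_mkTriple, d1, d2, d3, inner_sub_right _ (y.fst - zb), inner_neg_left, inner_neg_left,
        inner_sub_left, inner_sub_left ξ₁, inner_add_left, real_inner_smul_left,
        real_inner_smul_left, real_inner_smul_left, real_inner_smul_left,
        real_inner_comm (y.snd.snd - γ) (zb.snd - zk.snd)]
      ring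
    have hquad : ‖zb - zk‖ ^ 2 + 2 * inner ℝ (zb - zk) (y.fst - y.snd.fst - (zb - zk))
        ≤ ‖y.fst - y.snd.fst‖ ^ 2 := by
      have := norm_add_sq_real (zb - zk) (y.fst - y.snd.fst - (zb - zk))
      rw [add_sub_cancel] at this
      nlinarith [sq_nonneg ‖y.fst - y.snd.fst - (zb - zk)‖]
    -- The bilinear term in `(γ, r)` is not convex, but it is of second order in `d`; the ball of
    -- radius `ε / (μ + 1)` absorbs it into `ε‖d‖`.
    have hcross : -(ε * ‖d‖) ≤ μ * inner ℝ (y.snd.snd - γ) (y.fst.snd - zb.snd) := by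
      have h3 : ‖y.snd.snd - γ‖ ≤ ‖d‖ :=
        (WithLp.norm_snd_le _ d.snd).trans (WithLp.norm_snd_le _ d)
      have h4 : ‖y.fst.snd - zb.snd‖ ≤ ‖d‖ :=
        (WithLp.norm_snd_le _ d.fst).trans (WithLp.norm_fst_le _ d)
      have h5 := neg_le_of_abs_le (abs_real_inner_le_norm (y.snd.snd - γ) (y.fst.snd - zb.snd))
      have h6 : ‖y.snd.snd - γ‖ * ‖y.fst.snd - zb.snd‖ ≤ ‖d‖ * ‖d‖ := by gcongr
      have h7 : (μ + 1) * ‖d‖ ≤ ε := by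
        rw [lt_div_iff₀ (by positivity)] at hy
        linarith
      have h8 : (μ + 1) * ‖d‖ * ‖d‖ ≤ ε * ‖d‖ := by gcongr
      have h9 : μ * (-(‖d‖ * ‖d‖)) ≤ μ * inner ℝ (y.snd.snd - γ) (y.fst.snd - zb.snd) := by
        gcongr
        linarith
      nlinarith [mul_self_nonneg ‖d‖]
    have hn := h₂.2 y.fst hyS
    -- The change of multiplier from `γ` to `y.snd.snd` enters as a perturbation of the gap entry.
    have hs := hsub y.fst (inner ℝ (y.snd.snd - γ) (y.fst.snd - zk.snd)) 0
    have e1 : l y.fst.fst - l x + inner ℝ γ (y.fst.snd - zk.snd)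
        + inner ℝ (y.snd.snd - γ) (y.fst.snd - zk.snd)
        = l y.fst.fst + inner ℝ y.snd.snd y.fst.snd + (-inner ℝ y.snd.snd zk.snd - l x) := by
      simp only [inner_sub_left, inner_sub_right]
      ring
    have e2 : l zb.fst + inner ℝ γ zb.snd + (-inner ℝ γ zk.snd - l x)
        = l zb.fst - l x + inner ℝ γ (zb.snd - zk.snd) := by
      rw [inner_sub_right]
      ring
    have e3 : inner ℝ (y.snd.snd - γ) (y.fst.snd - zk.snd) = inner ℝ (y.snd.snd - γ) (zb.snd - zk.snd)
        + inner ℝ (y.snd.snd - γ) (y.fst.snd - zb.snd) := by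
      rw [← inner_add_right]
      congr 1
      abel
    rw [e1, e3] at hs
    simp only [Pi.zero_apply, mul_zero, Finset.sum_const_zero, add_zero] at hs
    have e4 : L (mkTriple zb zk γ).fst.fst + ρ / 4 * ‖(mkTriple zb zk γ).fst - (mkTriple zb zk γ).snd.fst‖ ^ 2
        + a * posMax (l (mkTriple zb zk γ).fst.fst + inner ℝ (mkTriple zb zk γ).snd.snd (mkTriple zb zk γ).fst.snd
          + (-inner ℝ γ zk.snd - l x)) (fun i => P i (mkTriple zb zk γ).fst.fst - (mkTriple zb zk γ).fst.snd i)
        = L zb.fst + ρ / 4 * ‖zb - zk‖ ^ 2 + a * posMax (l zb.fst - l x + inner ℝ γ (zb.snd - zk.snd))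
          (fun i => P i zb.fst - zb.snd i) := by
      rw [← e2]
      rfl
    rw [e4, hI]
    have := mul_le_mul_of_nonneg_left hquad (show 0 ≤ ρ / 4 by linarith)
    linarith
  · have h3 : ∀ (u v : Pt n J) (g : Vec J), ‖mkTriple u v g‖ ≤ ‖u‖ + ‖v‖ + ‖g‖ := fun u v g => by
      refine abs_le_of_sq_le_sq' ?_ (by positivity) |>.2
      rw [norm_sq_mkTriple]
      nlinarith [norm_nonneg u, norm_nonneg v, norm_nonneg g, mul_nonneg (norm_nonneg u) (norm_nonneg v),
        mul_nonneg (norm_nonneg u) (norm_nonneg g), mul_nonneg (norm_nonneg v) (norm_nonneg g)]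
    have h4 : ‖zb.snd - zk.snd‖ ≤ ‖zb - zk‖ := WithLp.norm_snd_le _ (zb - zk)
    have h5 : ‖(ρ / 2) • (zb - zk)‖ = ρ / 2 * ‖zb - zk‖ := by
      rw [norm_smul, Real.norm_of_nonneg (by linarith)]
    have h6 : ‖μ • (zb.snd - zk.snd)‖ ≤ a * ‖zb - zk‖ := by
      rw [norm_smul, Real.norm_of_nonneg hμ0]
      gcongr
    refine (h3 _ _ _).trans ?_
    have h7 := norm_sub_le (ξ₁ + ξ₂) ((ρ / 2) • (zb - zk))
    rw [norm_neg]
    linarith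

end Merit

end

end ValueFunctionDCA

namespace ValueFunctionDCA

noncomputable section

/-! ### Runs with a constant penalty parameter -/

section Run

variable {n J : ℕ} {L l : Vec n → ℝ} {P : Fin J → Vec n → ℝ} {ρ a c d : ℝ}
  {z : ℕ → Pt n J} {xt : ℕ → Vec n} {γ : ℕ → Vec J} {α : ℕ → ℝ}

/-- The part of a run along which the penalty parameter has the constant value `a`. -/
structure IsConstantPenaltyRun (L l : Vec n → ℝ) (P : Fin J → Vec n → ℝ) (ρ a c : ℝ)
    (z : ℕ → Pt n J) (xt : ℕ → Vec n) (γ : ℕ → Vec J) : Prop where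
  mem_sigma : ∀ k, z k ∈ sigmaSet n J
  lower_solution : ∀ k, xt k ∈ solutionSet l P (z k).snd
  multiplier : ∀ k, γ k ∈ multipliers l P (xt k) (z k).snd
  -- The distance need not be attained, hence the slack `ε`.
  inexact : ∀ k, ∀ ε : ℝ, 0 < ε →
    ∃ ξ₁ ∈ realSubdiff (subObjective L l P ρ a (z (k + 1)) (xt (k + 1)) (γ (k + 1))) (z (k + 2)),
      ∃ ξ₂ ∈ normalCone (sigmaSet n J) (z (k + 2)),
        ‖ξ₁ + ξ₂‖ ≤ √2 / 2 * ρ * ‖z (k + 1) - z k‖ + ε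
  no_update : ∀ k, ENNReal.ofReal c / ENNReal.ofReal ‖z (k + 1) - z k‖ ≤ max (ENNReal.ofReal a)
    (1 / ENNReal.ofReal (linGap l P (z k).snd (xt k) (γ k) (z (k + 1))))

/-- A bounded monotone sequence has increments tending to 0, but each increment is 0 or `d > 0`. -/
theorem IsVFiDCARun.exists_penalty_eq (h : IsVFiDCARun L l P ρ c d z xt γ α) (hd : 0 < d)
    (hα : Bornology.IsBounded (range α)) : ∃ K, ∃ a, 0 < a ∧ ∀ k, K ≤ k → α k = a := by
  have hmono : Monotone α := monotone_nat_of_le_succ fun k => by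
    rw [h.penalty_update k]
    split_ifs <;> linarith
  have hlim := tendsto_atTop_ciSup hmono hα.bddAbove
  have hdiff : Tendsto (fun k => α (k + 1) - α k) atTop (𝓝 0) := by
    simpa using ((tendsto_add_atTop_iff_nat 1).2 hlim).sub hlim
  obtain ⟨K, hK⟩ := eventually_atTop.1 (hdiff.eventually_lt_const hd)
  refine ⟨K, α K, h.penalty_pos.trans_le (hmono (Nat.zero_le K)), fun k hk => ?_⟩
  induction k, hk using Nat.le_induction with
  | base => rfl
  | succ k hk ih =>
    have h1 := hK k hk
    have h2 := h.penalty_update k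
    split_ifs at h2
    · linarith
    · exact h2.trans ih

theorem IsVFiDCARun.isConstantPenaltyRun (h : IsVFiDCARun L l P ρ c d z xt γ α) (hρ : 0 ≤ ρ)
    (hd : 0 < d) {K : ℕ} (hK : ∀ k, K ≤ k → α k = a) :
    IsConstantPenaltyRun L l P ρ a c (fun k => z (k + K)) (fun k => xt (k + K))
      (fun k => γ (k + K)) where
  mem_sigma k := h.mem_sigma _
  lower_solution k := h.lower_solution _
  multiplier k := h.multiplier _
  inexact k ε hε := by
    have h1 := h.inexact (k + K)
    have hnn : 0 ≤ √2 / 2 * ρ * ‖z (k + K + 1) - z (k + K)‖ := by positivity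
    have h2 := h1.trans_lt ((ENNReal.ofReal_lt_ofReal_iff (by linarith)).2 (lt_add_of_pos_right _ hε))
    obtain ⟨ξ, ⟨ξ₁, h₁, ξ₂, h₂, rfl⟩, hlt⟩ := Metric.infEDist_lt_iff.1 h2
    rw [hK _ (by omega)] at h₁
    rw [edist_dist, dist_zero_left, ENNReal.ofReal_lt_ofReal_iff (by linarith)] at hlt
    simp only [show k + 1 + K = k + K + 1 by ring, show k + 2 + K = k + K + 2 by ring]
    exact ⟨ξ₁, h₁, ξ₂, h₂, hlt.le⟩
  no_update k := by
    have h1 := h.penalty_update (k + K)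
    rw [hK _ (by omega), hK _ (by omega)] at h1
    split_ifs at h1 with hlt
    · linarith
    · simp only [show k + 1 + K = k + K + 1 by ring]
      exact not_lt.1 hlt

namespace IsConstantPenaltyRun

theorem valueFn_eq (h : IsConstantPenaltyRun L l P ρ a c z xt γ) (k : ℕ) :
    valueFn l P (z k).snd = l (xt k) := valueFn_eq_of_mem_solutionSet (h.lower_solution k)

theorem lower_bound (h : IsConstantPenaltyRun L l P ρ a c z xt γ) (k : ℕ) (r' : Vec J) (y : Vec n)
    (hy : y ∈ feasible P r') : l (xt k) - inner ℝ (γ k) (r' - (z k).snd) ≤ l y :=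
  multipliers_lower_bound (h.multiplier k) r' hy

/-- The merit value after the step from `z (k + 1)` to `z (k + 2)`. -/
def meritValue (L l : Vec n → ℝ) (P : Fin J → Vec n → ℝ) (ρ a : ℝ) (z : ℕ → Pt n J)
    (xt : ℕ → Vec n) (γ : ℕ → Vec J) (k : ℕ) : ℝ :=
  L (z (k + 2)).fst + ρ / 4 * ‖z (k + 2) - z (k + 1)‖ ^ 2
    + a * linGap l P (z (k + 1)).snd (xt (k + 1)) (γ (k + 1)) (z (k + 2))

theorem merit_eq (h : IsConstantPenaltyRun L l P ρ a c z xt γ) (k : ℕ) :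
    merit L l P ρ a (mkTriple (z (k + 2)) (z (k + 1)) (γ (k + 1)))
      = meritValue L l P ρ a z xt γ k := by
  rw [merit_eq_of_conjugate_eq (w := mkTriple (z (k + 2)) (z (k + 1)) (γ (k + 1)))
    (h.mem_sigma (k + 2)) (conjugate_valueFn_eq (h.valueFn_eq (k + 1)) (h.lower_bound (k + 1)))]
  congr 1
  have : l (z (k + 2)).fst + inner ℝ (γ (k + 1)) (z (k + 2)).snd
      + (-inner ℝ (γ (k + 1)) (z (k + 1)).snd - l (xt (k + 1)))
      = l (z (k + 2)).fst - l (xt (k + 1))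
        + inner ℝ (γ (k + 1)) ((z (k + 2)).snd - (z (k + 1)).snd) := by
    rw [inner_sub_right]
    ring
  change _ + a * posMax (l (z (k + 2)).fst + inner ℝ (γ (k + 1)) (z (k + 2)).snd
      + (-inner ℝ (γ (k + 1)) (z (k + 1)).snd - l (xt (k + 1)))) _ = _
  rw [this]
  rfl

/-- The proximal term yields `ρ D₂²`, where `D₁` and `D₂` are the previous and new step lengths. The
inexactness costs at most `(ρ/4) D₁² + (ρ/2) D₂²` and the merit function exchanges `(ρ/4) D₁²` for
`(ρ/4) D₂²`, leaving `(ρ/4) D₂²`. -/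
theorem meritValue_succ_le (h : IsConstantPenaltyRun L l P ρ a c z xt γ)
    (hL : ConvexOn ℝ univ L) (hl : ConvexOn ℝ univ l) (hP : ∀ i, ConvexOn ℝ univ (P i)) (hρ : 0 ≤ ρ) (ha : 0 ≤ a)
    (k : ℕ) : ρ / 4 * ‖z (k + 3) - z (k + 2)‖ ^ 2
      ≤ meritValue L l P ρ a z xt γ k - meritValue L l P ρ a z xt γ (k + 1) := by
  refine le_of_forall_pos_le_add fun ε hε => ?_
  obtain ⟨ξ₁, h₁, ξ₂, h₂, hξ⟩ := h.inexact (k + 1) (ε / (‖z (k + 3) - z (k + 2)‖ + 1)) (by positivity)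
  have hG := mem_realSubdiff.1 (sub_smul_mem_realSubdiff_penalized hL hl hP ha h₁) (z (k + 2))
  have hn := h₂.2 (z (k + 2)) (h.mem_sigma _)
  have hcs := neg_le_of_abs_le (abs_real_inner_le_norm (ξ₁ + ξ₂) (z (k + 2) - z (k + 3)))
  -- The new linearisation is exact at its base point, where the old one is at least as large
  -- because `v` lies above its affine minorant.
  have hgap : linGap l P (z (k + 2)).snd (xt (k + 2)) (γ (k + 2)) (z (k + 2))
      ≤ linGap l P (z (k + 1)).snd (xt (k + 1)) (γ (k + 1)) (z (k + 2)) := by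
    refine posMax_mono ?_ fun i => le_rfl
    have := h.lower_bound (k + 1) (z (k + 2)).snd (xt (k + 2)) (h.lower_solution (k + 2)).1
    rw [sub_self, inner_zero_right]
    linarith
  have hgap := mul_le_mul_of_nonneg_left hgap ha
  simp only [show k + 1 + 1 = k + 2 by ring, show k + 1 + 2 = k + 3 by ring] at *
  have e1 : inner ℝ (ξ₁ - ρ • (z (k + 3) - z (k + 2))) (z (k + 2) - z (k + 3))
      = inner ℝ ξ₁ (z (k + 2) - z (k + 3)) + ρ * ‖z (k + 3) - z (k + 2)‖ ^ 2 := by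
    rw [inner_sub_left, real_inner_smul_left, ← neg_sub (z (k + 3)) (z (k + 2)),
      inner_neg_right (z (k + 3) - z (k + 2)), real_inner_self_eq_norm_sq]
    ring
  rw [e1] at hG
  rw [inner_add_left, norm_sub_rev (z (k + 2)) (z (k + 3))] at hcs
  simp only [meritValue, show k + 1 + 1 = k + 2 by ring, show k + 1 + 2 = k + 3 by ring]
  set D₂ := ‖z (k + 3) - z (k + 2)‖
  set D₁ := ‖z (k + 2) - z (k + 1)‖
  have hD₂ : 0 ≤ D₂ := norm_nonneg _
  have h1 : ‖ξ₁ + ξ₂‖ * D₂ ≤ (√2 / 2 * ρ * D₁ + ε / (D₂ + 1)) * D₂ := by gcongr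
  have h2 : ε / (D₂ + 1) * D₂ ≤ ε := by
    rw [div_mul_eq_mul_div, div_le_iff₀ (by positivity)]
    nlinarith
  have h3 : √2 / 2 * (D₁ * D₂) ≤ D₁ ^ 2 / 4 + D₂ ^ 2 / 2 := by
    have := Real.sq_sqrt (show (0 : ℝ) ≤ 2 by norm_num)
    nlinarith [sq_nonneg (D₁ - √2 * D₂)]
  have h4 := mul_le_mul_of_nonneg_left h3 hρ
  linarith

theorem exists_mem_frechetSubdiff (h : IsConstantPenaltyRun L l P ρ a c z xt γ)
    (hL : ConvexOn ℝ univ L) (hl : ConvexOn ℝ univ l) (hP : ∀ i, ConvexOn ℝ univ (P i)) (hρ : 0 ≤ ρ)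
    (ha : 0 ≤ a) (k : ℕ) {ε : ℝ} (hε : 0 < ε) :
    ∃ ζ ∈ frechetSubdiff (merit L l P ρ a) (mkTriple (z (k + 2)) (z (k + 1)) (γ (k + 1))),
      ‖ζ‖ ≤ (ρ + a) * (‖z (k + 1) - z k‖ + ‖z (k + 2) - z (k + 1)‖) + ε := by
  obtain ⟨ξ₁, h₁, ξ₂, h₂, hξ⟩ := h.inexact k ε hε
  obtain ⟨ζ, hζ, hle⟩ := exists_mem_frechetSubdiff_merit hL hl hP hρ ha (h.valueFn_eq (k + 1))
    (h.lower_bound (k + 1)) h₁ h₂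
  refine ⟨ζ, hζ, hle.trans ?_⟩
  have h2 : √2 / 2 ≤ 1 := by
    have : √2 ≤ 2 := Real.sqrt_le_iff.2 ⟨by norm_num, by norm_num⟩
    linarith
  have h3 : √2 / 2 * ρ * ‖z (k + 1) - z k‖ ≤ (ρ + a) * ‖z (k + 1) - z k‖ := by
    gcongr
    nlinarith
  linarith

/-- With `t` the gap and `D` the step, no update means `c/D ≤ max(a, 1/t)`; for short steps the
first alternative fails, so `t ≤ D/c`. -/
theorem linGap_le (h : IsConstantPenaltyRun L l P ρ a c z xt γ) (ha : 0 ≤ a) (hc : 0 < c) (k : ℕ)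
    (hk : a * ‖z (k + 1) - z k‖ < c) :
    linGap l P (z k).snd (xt k) (γ k) (z (k + 1)) ≤ ‖z (k + 1) - z k‖ / c := by
  have hup := h.no_update k
  set D := ‖z (k + 1) - z k‖
  have ht0 : 0 ≤ linGap l P (z k).snd (xt k) (γ k) (z (k + 1)) := posMax_nonneg _ _
  set t := linGap l P (z k).snd (xt k) (γ k) (z (k + 1))
  have hD0 : 0 ≤ D := norm_nonneg _
  rcases ht0.eq_or_lt with h0 | htpos
  · rw [← h0]
    positivity
  have ht : 1 / ENNReal.ofReal t = ENNReal.ofReal (1 / t) := by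
    rw [ENNReal.ofReal_div_of_pos htpos, ENNReal.ofReal_one]
  rw [ht] at hup
  -- For `D = 0` the quotient `c/D` is `⊤`, which is impossible when `t > 0`.
  rcases hD0.eq_or_lt with h0 | hDpos
  · exfalso
    rw [← h0, ENNReal.ofReal_zero, ENNReal.div_zero (by simpa using hc), top_le_iff] at hup
    rcases max_choice (ENNReal.ofReal a) (ENNReal.ofReal (1 / t)) with h1 | h1 <;>
      · rw [h1] at hup
        exact ENNReal.ofReal_ne_top hup
  rw [← ENNReal.ofReal_div_of_pos hDpos, le_max_iff, ENNReal.ofReal_le_ofReal_iff ha,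
    ENNReal.ofReal_le_ofReal_iff (div_nonneg zero_le_one ht0)] at hup
  rcases hup with h1 | h1
  · rw [div_le_iff₀ hDpos] at h1
    linarith
  · rw [div_le_div_iff₀ hDpos htpos] at h1
    rw [le_div_iff₀ hc]
    linarith

theorem isBounded_range_multiplier (h : IsConstantPenaltyRun L l P ρ a c z xt γ)
    (hLL : ∀ r : Vec J, (∀ i, 0 < r i) → (feasible P r).Nonempty ∧ BddBelow (l '' feasible P r))
    (hz : Bornology.IsBounded (range z)) {δ : ℝ} (hδ : 0 < δ) (hzδ : ∀ k i, δ ≤ (z k).snd i) :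
    Bornology.IsBounded (range γ) := by
  obtain ⟨R, hR0, hR⟩ := hz.exists_pos_norm_le
  -- A Slater point: `y` leaves slack at least `δ/2` in every constraint along the run, while `l` is
  -- bounded below on the largest feasible set that can occur.
  obtain ⟨y, hy⟩ := (hLL (WithLp.toLp 2 fun _ => δ / 2) (fun i => by simpa using hδ)).1
  obtain ⟨m, hm⟩ := (hLL (WithLp.toLp 2 fun _ => R) (fun i => hR0)).2
  have hsum : ∀ k, δ / 2 * ∑ i, γ k i ≤ l y - m := fun k => by
    have h1 := h.lower_bound k _ y hy
    have h2 : m ≤ l (xt k) := hm ⟨xt k, fun i => ((h.lower_solution k).1 i).trans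
      ((le_abs_self _).trans ((PiLp.norm_apply_le (z k).snd i).trans
        ((WithLp.norm_snd_le _ (z k)).trans (hR _ ⟨k, rfl⟩)))), rfl⟩
    rw [inner_eq_sum_mul] at h1
    have h3 : ∑ i, γ k i * ((WithLp.toLp 2 fun _ => δ / 2 : Vec J) - (z k).snd) i
        ≤ ∑ i, γ k i * (-(δ / 2)) := Finset.sum_le_sum fun i _ => by
      refine mul_le_mul_of_nonneg_left ?_ ((h.multiplier k).1 i)
      simp only [PiLp.sub_apply]
      linarith [hzδ k i]
    rw [← Finset.sum_mul] at h3
    linarith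
  refine isBounded_iff_forall_norm_le.2 ⟨2 / δ * (l y - m), ?_⟩
  rintro _ ⟨k, rfl⟩
  have h1 : ‖γ k‖ ≤ ∑ i, γ k i := by
    have h0 : 0 ≤ ∑ i, γ k i := Finset.sum_nonneg fun i _ => (h.multiplier k).1 i
    refine abs_le_of_sq_le_sq' ?_ h0 |>.2
    rw [EuclideanSpace.real_norm_sq_eq]
    exact Finset.sum_sq_le_sq_sum_of_nonneg fun i _ => (h.multiplier k).1 i
  have h2 := hsum k
  refine h1.trans ?_
  rw [div_mul_eq_mul_div, le_div_iff₀ hδ]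
  linarith

end IsConstantPenaltyRun

end Run

end

end ValueFunctionDCA

namespace ValueFunctionDCA

noncomputable section

/-! ### Limit points of a run -/

section Limit

variable {n J : ℕ} {L l : Vec n → ℝ} {P : Fin J → Vec n → ℝ} {ρ a c : ℝ}
  {z : ℕ → Pt n J} {xt : ℕ → Vec n} {γ : ℕ → Vec J}

namespace IsConstantPenaltyRun

theorem exists_tendsto_meritValue (h : IsConstantPenaltyRun L l P ρ a c z xt γ)
    (hL : ConvexOn ℝ univ L) (hl : ConvexOn ℝ univ l) (hP : ∀ i, ConvexOn ℝ univ (P i))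
    (hLbdd : BddBelow (range L)) (hρ : 0 < ρ) (ha : 0 ≤ a) :
    (∃ e', Tendsto (meritValue L l P ρ a z xt γ) atTop (𝓝 e')) ∧
      Tendsto (fun k => ‖z (k + 1) - z k‖) atTop (𝓝 0) := by
  have hanti : Antitone (meritValue L l P ρ a z xt γ) := antitone_nat_of_succ_le fun k => by
    have := h.meritValue_succ_le hL hl hP hρ.le ha k
    have : 0 ≤ ρ / 4 * ‖z (k + 3) - z (k + 2)‖ ^ 2 := by positivity
    linarith
  obtain ⟨m, hm⟩ := hLbdd
  have hbdd : BddBelow (range (meritValue L l P ρ a z xt γ)) := by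
    refine ⟨m, ?_⟩
    rintro _ ⟨k, rfl⟩
    have h1 : m ≤ L (z (k + 2)).fst := hm ⟨_, rfl⟩
    have h2 : 0 ≤ ρ / 4 * ‖z (k + 2) - z (k + 1)‖ ^ 2 := by positivity
    have h3 := mul_nonneg ha (posMax_nonneg (l (z (k + 2)).fst - l (xt (k + 1))
      + inner ℝ (γ (k + 1)) ((z (k + 2)).snd - (z (k + 1)).snd))
      (fun i => P i (z (k + 2)).fst - (z (k + 2)).snd i))
    have h4 : 0 ≤ a * linGap l P (z (k + 1)).snd (xt (k + 1)) (γ (k + 1)) (z (k + 2)) := h3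
    simp only [meritValue]
    linarith
  have hlim := tendsto_atTop_ciInf hanti hbdd
  refine ⟨⟨_, hlim⟩, ?_⟩
  have hdiff : Tendsto (fun k => meritValue L l P ρ a z xt γ k - meritValue L l P ρ a z xt γ (k + 1))
      atTop (𝓝 0) := by
    simpa using hlim.sub ((tendsto_add_atTop_iff_nat 1).2 hlim)
  have hsq : Tendsto (fun k => ‖z (k + 3) - z (k + 2)‖ ^ 2) atTop (𝓝 0) := by
    have h4 : Tendsto (fun k => 4 / ρ * (meritValue L l P ρ a z xt γ k
        - meritValue L l P ρ a z xt γ (k + 1))) atTop (𝓝 0) := by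
      simpa using hdiff.const_mul (4 / ρ)
    refine squeeze_zero (fun k => sq_nonneg _) (fun k => ?_) h4
    have := h.meritValue_succ_le hL hl hP hρ.le ha k
    rw [div_mul_eq_mul_div, le_div_iff₀ hρ]
    linarith
  refine (tendsto_add_atTop_iff_nat 2).1 ?_
  have := hsq.sqrt
  simpa [Real.sqrt_sq] using this

theorem tendsto_linGap (h : IsConstantPenaltyRun L l P ρ a c z xt γ) (ha : 0 ≤ a) (hc : 0 < c)
    (hD : Tendsto (fun k => ‖z (k + 1) - z k‖) atTop (𝓝 0)) :
    Tendsto (fun k => linGap l P (z k).snd (xt k) (γ k) (z (k + 1))) atTop (𝓝 0) := by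
  have h1 : Tendsto (fun k => a * ‖z (k + 1) - z k‖) atTop (𝓝 0) := by simpa using hD.const_mul a
  have h2 : Tendsto (fun k => ‖z (k + 1) - z k‖ / c) atTop (𝓝 0) := by simpa using hD.div_const c
  refine tendsto_of_tendsto_of_tendsto_of_le_of_le' tendsto_const_nhds h2
    (Eventually.of_forall fun k => posMax_nonneg _ _) ?_
  filter_upwards [h1.eventually_lt_const hc] with k hk using h.linGap_le ha hc k hk

theorem tendsto_shift {φ : ℕ → ℕ} (hφ : Tendsto φ atTop atTop) {zb : Pt n J}
    (hz : Tendsto (fun k => z (φ k + 1)) atTop (𝓝 zb))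
    (hD : Tendsto (fun k => ‖z (k + 1) - z k‖) atTop (𝓝 0)) :
    Tendsto (fun k => z (φ k + 2)) atTop (𝓝 zb) := by
  have h1 : Tendsto (fun k => z (φ k + 2) - z (φ k + 1)) atTop (𝓝 0) :=
    tendsto_zero_iff_norm_tendsto_zero.2 (hD.comp ((tendsto_add_atTop_nat 1).comp hφ))
  simpa using h1.add hz

theorem tendsto_fst {u : ℕ → Pt n J} {zb : Pt n J} (h : Tendsto u atTop (𝓝 zb)) :
    Tendsto (fun k => (u k).fst) atTop (𝓝 zb.fst) :=
  ((WithLp.continuous_fst 2 _ _).tendsto zb).comp h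

theorem tendsto_snd {u : ℕ → Pt n J} {zb : Pt n J} (h : Tendsto u atTop (𝓝 zb)) :
    Tendsto (fun k => (u k).snd) atTop (𝓝 zb.snd) :=
  ((WithLp.continuous_snd 2 _ _).tendsto zb).comp h

theorem tendsto_apply {u : ℕ → Vec J} {v : Vec J} (h : Tendsto u atTop (𝓝 v)) (i : Fin J) :
    Tendsto (fun k => u k i) atTop (𝓝 (v i)) :=
  ((EuclideanSpace.proj (𝕜 := ℝ) i).continuous.tendsto v).comp h

theorem limit_mem_feasible (h : IsConstantPenaltyRun L l P ρ a c z xt γ)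
    (hP : ∀ i, ConvexOn ℝ univ (P i)) (ha : 0 ≤ a) (hc : 0 < c)
    (hD : Tendsto (fun k => ‖z (k + 1) - z k‖) atTop (𝓝 0)) {φ : ℕ → ℕ}
    (hφ : Tendsto φ atTop atTop) {zb : Pt n J}
    (hz : Tendsto (fun k => z (φ k + 1)) atTop (𝓝 zb)) : zb.fst ∈ feasible P zb.snd := by
  intro i
  have ht := (h.tendsto_linGap ha hc hD).comp ((tendsto_add_atTop_nat 1).comp hφ)
  have hz2 := tendsto_shift hφ hz hD
  have h1 := (((hP i).continuous_of_finiteDimensional.tendsto zb.fst).comp (tendsto_fst hz2)).sub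
    (tendsto_apply (tendsto_snd hz2) i)
  have h2 := le_of_tendsto_of_tendsto' h1 ht fun k =>
    le_posMax_right _ (fun i => P i (z (φ k + 2)).fst - (z (φ k + 2)).snd i) i
  linarith

/-- The lower-level solutions `xt k` need not converge. The vanishing gap bounds `l(z) - l(xt)` from
above, so `l (xt k)` can be replaced by `l zb.fst` in the limit. -/
theorem limit_lower_bound (h : IsConstantPenaltyRun L l P ρ a c z xt γ)
    (hl : ConvexOn ℝ univ l) (ha : 0 ≤ a) (hc : 0 < c)
    (hD : Tendsto (fun k => ‖z (k + 1) - z k‖) atTop (𝓝 0)) {φ : ℕ → ℕ}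
    (hφ : Tendsto φ atTop atTop) {zb : Pt n J} {γb : Vec J}
    (hz : Tendsto (fun k => z (φ k + 1)) atTop (𝓝 zb))
    (hγ : Tendsto (fun k => γ (φ k + 1)) atTop (𝓝 γb)) (r' : Vec J) (y : Vec n)
    (hy : y ∈ feasible P r') : l zb.fst - inner ℝ γb (r' - zb.snd) ≤ l y := by
  have ht := (h.tendsto_linGap ha hc hD).comp ((tendsto_add_atTop_nat 1).comp hφ)
  have hz2 := tendsto_shift hφ hz hD
  have h1 := (((hl.continuous_of_finiteDimensional.tendsto zb.fst).comp (tendsto_fst hz2)).add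
    (hγ.inner ((tendsto_snd hz2).sub (tendsto_snd hz)))).sub ht
  have h2 := h1.sub (hγ.inner ((tendsto_const_nhds (x := r')).sub (tendsto_snd hz)))
  rw [sub_self, inner_zero_right, add_zero, sub_zero] at h2
  refine le_of_tendsto h2 (Eventually.of_forall fun k => ?_)
  have h3 := h.lower_bound (φ k + 1) r' y hy
  have h4 := le_posMax_left (l (z (φ k + 2)).fst - l (xt (φ k + 1))
      + inner ℝ (γ (φ k + 1)) ((z (φ k + 2)).snd - (z (φ k + 1)).snd))
      (fun i => P i (z (φ k + 2)).fst - (z (φ k + 2)).snd i)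
  change _ ≤ linGap l P (z (φ k + 1)).snd (xt (φ k + 1)) (γ (φ k + 1)) (z (φ k + 1 + 1)) at h4
  simp only [Function.comp_apply]
  linarith

theorem limit_valueFn_eq (h : IsConstantPenaltyRun L l P ρ a c z xt γ)
    (hl : ConvexOn ℝ univ l) (hP : ∀ i, ConvexOn ℝ univ (P i)) (ha : 0 ≤ a) (hc : 0 < c)
    (hD : Tendsto (fun k => ‖z (k + 1) - z k‖) atTop (𝓝 0)) {φ : ℕ → ℕ}
    (hφ : Tendsto φ atTop atTop) {zb : Pt n J} {γb : Vec J}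
    (hz : Tendsto (fun k => z (φ k + 1)) atTop (𝓝 zb))
    (hγ : Tendsto (fun k => γ (φ k + 1)) atTop (𝓝 γb)) : valueFn l P zb.snd = l zb.fst := by
  refine valueFn_eq_of_mem_solutionSet ⟨h.limit_mem_feasible hP ha hc hD hφ hz, fun y hy => ?_⟩
  have := h.limit_lower_bound hl ha hc hD hφ hz hγ zb.snd y hy
  rwa [sub_self, inner_zero_right, sub_zero] at this

theorem limit_mem_sigma (h : IsConstantPenaltyRun L l P ρ a c z xt γ) {φ : ℕ → ℕ} {zb : Pt n J}
    (hz : Tendsto (fun k => z (φ k + 1)) atTop (𝓝 zb)) : zb ∈ sigmaSet n J := fun i =>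
  ge_of_tendsto' (tendsto_apply (tendsto_snd hz) i) fun k => h.mem_sigma (φ k + 1) i

/-- At a cluster point both copies of `z` agree and the penalty vanishes, so the merit value is `L`,
the limit of the values along the run. The regular subgradients tend to 0 with the steps. -/
theorem limit_merit (h : IsConstantPenaltyRun L l P ρ a c z xt γ)
    (hL : ConvexOn ℝ univ L) (hl : ConvexOn ℝ univ l) (hP : ∀ i, ConvexOn ℝ univ (P i))
    (hρ : 0 ≤ ρ) (ha : 0 ≤ a) (hc : 0 < c)
    (hD : Tendsto (fun k => ‖z (k + 1) - z k‖) atTop (𝓝 0)) {e' : ℝ}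
    (he : Tendsto (meritValue L l P ρ a z xt γ) atTop (𝓝 e')) {φ : ℕ → ℕ}
    (hφ : Tendsto φ atTop atTop) {w : Triple n J}
    (hw : Tendsto (fun k => mkTriple (z (φ k + 2)) (z (φ k + 1)) (γ (φ k + 1))) atTop (𝓝 w)) :
    merit L l P ρ a w = e' ∧ 0 ∈ limitingSubdiff (merit L l P ρ a) w := by
  have hz2 : Tendsto (fun k => z (φ k + 2)) atTop (𝓝 w.fst) :=
    ((WithLp.continuous_fst 2 _ _).tendsto w).comp hw
  have hsnd : Tendsto (fun k => WithLp.toLp 2 (z (φ k + 1), γ (φ k + 1))) atTop (𝓝 w.snd) :=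
    ((WithLp.continuous_snd 2 _ _).tendsto w).comp hw
  have hz : Tendsto (fun k => z (φ k + 1)) atTop (𝓝 w.snd.fst) :=
    ((WithLp.continuous_fst 2 _ _).tendsto w.snd).comp hsnd
  have hγ : Tendsto (fun k => γ (φ k + 1)) atTop (𝓝 w.snd.snd) :=
    ((WithLp.continuous_snd 2 _ _).tendsto w.snd).comp hsnd
  have heq : w.snd.fst = w.fst := tendsto_nhds_unique (tendsto_shift hφ hz hD) hz2
  rw [heq] at hz
  have hv := h.limit_valueFn_eq hl hP ha hc hD hφ hz hγ
  have hfeas := h.limit_mem_feasible hP ha hc hD hφ hz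
  have hm := merit_eq_of_conjugate_eq (L := L) (ρ := ρ) (a := a) (w := w) (h.limit_mem_sigma hz)
    (conjugate_valueFn_eq hv (h.limit_lower_bound hl ha hc hD hφ hz hγ))
  have hpos : posMax (l w.fst.fst + inner ℝ w.snd.snd w.fst.snd
      + (-inner ℝ w.snd.snd w.fst.snd - l w.fst.fst)) (fun i => P i w.fst.fst - w.fst.snd i) = 0 :=
    le_antisymm (posMax_le_iff.2 ⟨le_rfl, by linarith, fun i => sub_nonpos.2 (hfeas i)⟩)
      (posMax_nonneg _ _)
  rw [hpos, heq, sub_self, norm_zero] at hm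
  have hval : L w.fst.fst + ρ / 4 * 0 ^ 2 + a * 0 = e' := by
    refine tendsto_nhds_unique ?_ (he.comp hφ)
    have h1 := hD.comp ((tendsto_add_atTop_nat 1).comp hφ)
    have h2 := (h.tendsto_linGap ha hc hD).comp ((tendsto_add_atTop_nat 1).comp hφ)
    exact (((hL.continuous_of_finiteDimensional.tendsto _).comp (tendsto_fst hz2)).add
      ((h1.pow 2).const_mul (ρ / 4))).add (h2.const_mul a)
  rw [hval] at hm
  refine ⟨hm, by rw [hm]; exact EReal.coe_ne_top _, by rw [hm]; exact EReal.coe_ne_bot _, ?_⟩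
  choose ζ hζ hζn using fun k => h.exists_mem_frechetSubdiff hL hl hP hρ ha (φ k)
    (Nat.one_div_pos_of_nat (α := ℝ) (n := k))
  refine ⟨_, ζ, hζ, hw, ?_, ?_⟩
  · rw [hm]
    simp only [h.merit_eq]
    exact (continuous_coe_real_ereal.tendsto e').comp (he.comp hφ)
  · refine squeeze_zero_norm hζn ?_
    have h1 := ((hD.comp hφ).add (hD.comp ((tendsto_add_atTop_nat 1).comp hφ))).const_mul (ρ + a)
    have h2 := h1.add (tendsto_one_div_add_atTop_nhds_zero_nat (𝕜 := ℝ))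
    rw [add_zero, add_zero, mul_zero] at h2
    exact h2

/-- Convergence of the iterates under the KL property of the merit function. -/
theorem exists_tendsto (h : IsConstantPenaltyRun L l P ρ a c z xt γ)
    (hL : ConvexOn ℝ univ L) (hl : ConvexOn ℝ univ l) (hP : ∀ i, ConvexOn ℝ univ (P i))
    (hLbdd : BddBelow (range L)) (hρ : 0 < ρ) (ha : 0 ≤ a) (hc : 0 < c)
    (hz : Bornology.IsBounded (range z)) (hγ : Bornology.IsBounded (range γ))
    (hKL : IsKLFunction (merit L l P ρ a)) : ∃ zb, Tendsto z atTop (𝓝 zb) := by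
  obtain ⟨⟨e', he⟩, hD⟩ := h.exists_tendsto_meritValue hL hl hP hLbdd hρ ha
  obtain ⟨R, hR⟩ := isBounded_iff_forall_norm_le.1 hz
  obtain ⟨R', hR'⟩ := isBounded_iff_forall_norm_le.1 hγ
  have hball : ∀ k, mkTriple (z (k + 2)) (z (k + 1)) (γ (k + 1)) ∈
      Metric.closedBall (0 : Triple n J) (√(R ^ 2 + (R ^ 2 + R' ^ 2))) := fun k => by
    rw [mem_closedBall_zero_iff]
    refine Real.le_sqrt_of_sq_le ?_
    rw [norm_sq_mkTriple]
    gcongr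
    · exact hR _ ⟨_, rfl⟩
    · exact hR _ ⟨_, rfl⟩
    · exact hR' _ ⟨_, rfl⟩
  obtain ⟨η, hη, φ, ψ, hφ, hev⟩ := exists_uniform_slopeBound (isCompact_closedBall _ _) hball
    h.merit_eq (e' := e') fun y hy => by
      obtain ⟨θ, hθ, hlim⟩ := hy.tendsto_subseq
      obtain ⟨h1, h2⟩ := h.limit_merit hL hl hP hρ.le ha hc hD he hθ.tendsto_atTop hlim
      exact ⟨h1, hKL.kl y ⟨0, h2⟩⟩
  have hsum : Summable (fun k => ‖z (k + 1) - z k‖) := by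
    refine summable_of_slopeBound (a := ρ / 4) (b := ρ + a) (by positivity) (by positivity)
      (fun k => norm_nonneg _) (fun k => h.meritValue_succ_le hL hl hP hρ.le ha k) he hη hφ ?_
    filter_upwards [hev] with k hk h1 h2
    have hψ := hφ.slope_nonneg (meritValue L l P ρ a z xt γ k - e') (by linarith) (by linarith)
    refine le_of_forall_pos_le_add fun ε hε => ?_
    obtain ⟨ζ, hζ, hle⟩ := h.exists_mem_frechetSubdiff hL hl hP hρ.le ha k
      (ε := ε / (ψ (meritValue L l P ρ a z xt γ k - e') + 1)) (by positivity)
    have h3 := hk h1 h2 ζ ⟨hζ.1, hζ.2.1, fun _ => _, fun _ => ζ, fun _ => hζ, tendsto_const_nhds,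
      tendsto_const_nhds, tendsto_const_nhds⟩
    have h4 := h3.trans (mul_le_mul_of_nonneg_left hle hψ)
    have h5 : ψ (meritValue L l P ρ a z xt γ k - e')
        * (ε / (ψ (meritValue L l P ρ a z xt γ k - e') + 1)) ≤ ε := by
      rw [← mul_div_assoc, div_le_iff₀ (by positivity)]
      nlinarith
    rw [mul_add] at h4
    linarith
  refine cauchySeq_tendsto_of_complete (cauchySeq_of_summable_dist ?_)
  simpa only [dist_eq_norm, norm_sub_rev] using hsum

end IsConstantPenaltyRun

end Limit

end

end ValueFunctionDCA

namespace ValueFunctionDCA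

noncomputable section

/-! ### Stationarity of the limit -/

section Stationary

variable {n J : ℕ} {L l : Vec n → ℝ} {P : Fin J → Vec n → ℝ} {ρ a c : ℝ}
  {z : ℕ → Pt n J} {xt : ℕ → Vec n} {γ : ℕ → Vec J}

namespace IsConstantPenaltyRun

/-- Approximate multipliers for the subproblems. -/
theorem exists_approx_multipliers (h : IsConstantPenaltyRun L l P ρ a c z xt γ)
    (hL : ConvexOn ℝ univ L) (hl : ConvexOn ℝ univ l) (hP : ∀ i, ConvexOn ℝ univ (P i))
    (ha : 0 ≤ a) (k : ℕ) {ε : ℝ} (hε : 0 < ε) :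
    ∃ (μ : ℝ) (lam : Fin J → ℝ) (ζ : Pt n J), 0 ≤ μ ∧ μ ≤ a ∧ (∀ i, 0 ≤ lam i) ∧
      (∀ i, lam i ≤ a) ∧ (∀ i, P i (z (k + 2)).fst - (z (k + 2)).snd i < 0 → lam i = 0) ∧
      ‖ζ‖ ≤ √2 / 2 * ρ * ‖z (k + 1) - z k‖ + ε + ‖ρ • (z (k + 2) - z (k + 1))‖ ∧
      ∀ y ∈ sigmaSet n J,
        L (z (k + 2)).fst + μ * l (z (k + 2)).fst
            + ∑ i, lam i * (P i (z (k + 2)).fst - (z (k + 2)).snd i) + inner ℝ ζ (y - z (k + 2))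
          ≤ L y.fst + μ * (l y.fst + inner ℝ (γ (k + 1)) (y.snd - (z (k + 2)).snd))
            + ∑ i, lam i * (P i y.fst - y.snd i) := by
  obtain ⟨ξ₁, h₁, ξ₂, h₂, hξ⟩ := h.inexact k ε hε
  obtain ⟨μ, lam, hμ0, hμ, hlam0, hlam, hcomp, hsub⟩ :=
    exists_multipliers (f := fun z : Pt n J => L z.fst) ha
      (convexOn_comp_fst hL) (convexOn_gap hl (z (k + 1)).snd (xt (k + 1)) (γ (k + 1)))
      (convexOn_constraint hP) (sub_smul_mem_realSubdiff_penalized hL hl hP ha h₁)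
  refine ⟨μ, lam, ξ₁ + ξ₂ - ρ • (z (k + 2) - z (k + 1)), hμ0, hμ, hlam0, hlam, hcomp,
    (norm_sub_le _ _).trans (add_le_add hξ le_rfl), fun y hy => ?_⟩
  set zb := z (k + 2)
  set zk := z (k + 1)
  -- The perturbations make the entries of the maximum at `y` equal to those at `zb`; the maxima
  -- cancel and a Lagrangian inequality remains.
  have hs := hsub y
    ((l zb.fst - l (xt (k + 1)) + inner ℝ (γ (k + 1)) (zb.snd - zk.snd))
      - (l y.fst - l (xt (k + 1)) + inner ℝ (γ (k + 1)) (y.snd - zk.snd)))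
    (fun i => (P i zb.fst - zb.snd i) - (P i y.fst - y.snd i))
  simp only [add_sub_cancel, mul_sub (lam _) (_ - _) (_ - _), Finset.sum_sub_distrib] at hs
  have hn := h₂.2 y hy
  have e1 : inner ℝ (γ (k + 1)) (y.snd - zk.snd) = inner ℝ (γ (k + 1)) (y.snd - zb.snd)
      + inner ℝ (γ (k + 1)) (zb.snd - zk.snd) := by
    rw [← inner_add_right, sub_add_sub_cancel]
  have e2 : inner ℝ (ξ₁ + ξ₂ - ρ • (zb - zk)) (y - zb)
      = inner ℝ (ξ₁ - ρ • (zb - zk)) (y - zb) + inner ℝ ξ₂ (y - zb) := by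
    rw [← inner_add_left]
    congr 1
    abel
  rw [e1] at hs
  rw [e2]
  linarith

theorem isKKTStationary_of_tendsto (h : IsConstantPenaltyRun L l P ρ a c z xt γ)
    (hL : ConvexOn ℝ univ L) (hl : ConvexOn ℝ univ l) (hP : ∀ i, ConvexOn ℝ univ (P i))
    (ha : 0 ≤ a) (hc : 0 < c) (hγ : Bornology.IsBounded (range γ)) {δ : ℝ} (hδ : 0 < δ)
    (hzδ : ∀ k i, δ ≤ (z k).snd i) {zb : Pt n J} (hz : Tendsto z atTop (𝓝 zb)) :
    IsKKTStationary L l P zb := by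
  have hz1 : Tendsto (fun k => z (k + 1)) atTop (𝓝 zb) := (tendsto_add_atTop_iff_nat 1).2 hz
  have hz2 : Tendsto (fun k => z (k + 2)) atTop (𝓝 zb) := (tendsto_add_atTop_iff_nat 2).2 hz
  have hD : Tendsto (fun k => ‖z (k + 1) - z k‖) atTop (𝓝 0) := by
    simpa using (hz1.sub hz).norm
  choose μ lam ζ hμ0 hμ hlam0 hlam hcomp hζ hineq using fun k =>
    h.exists_approx_multipliers hL hl hP ha k (Nat.one_div_pos_of_nat (α := ℝ) (n := k))
  have hζ0 : Tendsto ζ atTop (𝓝 0) := by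
    refine squeeze_zero_norm hζ ?_
    have h1 := ((hD.const_mul (√2 / 2 * ρ)).add (tendsto_one_div_add_atTop_nhds_zero_nat (𝕜 := ℝ))).add
      ((hz2.sub hz1).const_smul ρ).norm
    simpa using h1
  obtain ⟨R, hR⟩ := isBounded_iff_forall_norm_le.1 hγ
  obtain ⟨⟨μb, lamb, γb⟩, -, φ, hφ, hlim⟩ := tendsto_subseq_of_bounded
    (s := Icc 0 a ×ˢ (Set.pi univ fun _ : Fin J => Icc (0 : ℝ) a) ×ˢ Metric.closedBall (0 : Vec J) R)
    (((Metric.isBounded_Icc 0 a).prod ((Bornology.IsBounded.pi fun _ => Metric.isBounded_Icc 0 a).prod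
      Metric.isBounded_closedBall)))
    (x := fun k => (μ k, lam k, γ (k + 1)))
    (fun k => ⟨⟨hμ0 k, hμ k⟩, fun i _ => ⟨hlam0 k i, hlam k i⟩,
      mem_closedBall_zero_iff.2 (hR _ ⟨_, rfl⟩)⟩)
  have hφt := hφ.tendsto_atTop
  have hμl : Tendsto (fun k => μ (φ k)) atTop (𝓝 μb) := (continuous_fst.tendsto _).comp hlim
  have hlaml : ∀ i, Tendsto (fun k => lam (φ k) i) atTop (𝓝 (lamb i)) := fun i =>
    (((continuous_apply i).comp (continuous_fst.comp continuous_snd)).tendsto _).comp hlim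
  have hγl : Tendsto (fun k => γ (φ k + 1)) atTop (𝓝 γb) :=
    ((continuous_snd.comp continuous_snd).tendsto _).comp hlim
  have hzφ1 : Tendsto (fun k => z (φ k + 1)) atTop (𝓝 zb) := hz1.comp hφt
  have hzφ : Tendsto (fun k => z (φ k + 2)) atTop (𝓝 zb) := hz2.comp hφt
  have hσ := h.limit_mem_sigma hzφ1
  have hv := h.limit_valueFn_eq hl hP ha hc hD hφt hzφ1 hγl
  have hlb := h.limit_lower_bound hl ha hc hD hφt hzφ1 hγl
  have hfeas := h.limit_mem_feasible hP ha hc hD hφt hzφ1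
  have hzbδ : ∀ i, δ ≤ zb.snd i := fun i =>
    ge_of_tendsto' (tendsto_apply (tendsto_snd hz) i) fun k => hzδ k i
  have hμb : 0 ≤ μb := ge_of_tendsto' hμl fun k => hμ0 _
  have hlamb : ∀ i, 0 ≤ lamb i := fun i => ge_of_tendsto' (hlaml i) fun k => hlam0 _ i
  have hcont : ∀ {f : Vec n → ℝ}, ConvexOn ℝ univ f →
      Tendsto (fun k => f (z (φ k + 2)).fst) atTop (𝓝 (f zb.fst)) := fun hf =>
    (hf.continuous_of_finiteDimensional.tendsto _).comp (tendsto_fst hzφ)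
  have hcompl : ∀ i, lamb i * (P i zb.fst - zb.snd i) = 0 := fun i => by
    rcases (hfeas i).lt_or_eq with hlt | heq
    · have h1 := (hcont (hP i)).sub (tendsto_apply (tendsto_snd hzφ) i)
      have h2 : Tendsto (fun k => lam (φ k) i) atTop (𝓝 0) := by
        refine tendsto_const_nhds.congr' ?_
        filter_upwards [h1.eventually_lt_const (sub_neg.2 hlt)] with k hk using (hcomp _ i hk).symm
      rw [tendsto_nhds_unique (hlaml i) h2, zero_mul]
    · rw [heq, sub_self, mul_zero]
  have hlimit : ∀ y ∈ sigmaSet n J, L zb.fst + μb * l zb.fst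
      + ∑ i, lamb i * (P i zb.fst - zb.snd i)
      ≤ L y.fst + μb * (l y.fst + inner ℝ γb (y.snd - zb.snd))
        + ∑ i, lamb i * (P i y.fst - y.snd i) := fun y hy => by
    have h1 := (((hcont hL).add (hμl.mul (hcont hl))).add (tendsto_finsetSum Finset.univ
      fun i _ => (hlaml i).mul ((hcont (hP i)).sub (tendsto_apply (tendsto_snd hzφ) i)))).add
      ((hζ0.comp hφt).inner ((tendsto_const_nhds (x := y)).sub hzφ))
    have h2 := ((tendsto_const_nhds (x := L y.fst)).add (hμl.mul
      ((tendsto_const_nhds (x := l y.fst)).add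
        (hγl.inner ((tendsto_const_nhds (x := y.snd)).sub (tendsto_snd hzφ)))))).add
      (tendsto_finsetSum Finset.univ fun i _ =>
        (hlaml i).mul (tendsto_const_nhds (x := P i y.fst - y.snd i)))
    have h3 := le_of_tendsto_of_tendsto' h1 h2 fun k => hineq (φ k) y hy
    rwa [inner_zero_left, add_zero] at h3
  -- Every `r i` can move by `δ` in both directions inside the orthant, so the coefficient of this
  -- linear perturbation must vanish.
  have hlamγ : ∀ i, lamb i = μb * γb i := fun i => by
    have hdir : ∀ t : ℝ, -δ ≤ t → 0 ≤ t * (μb * γb i - lamb i) := fun t ht => by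
      have hmem : WithLp.toLp 2 (zb.fst, zb.snd + EuclideanSpace.single i t) ∈ sigmaSet n J := by
        intro j
        change 0 ≤ zb.snd j + (EuclideanSpace.single i t : Vec J) j
        rw [PiLp.single_apply]
        split_ifs <;> linarith [hzbδ j]
      have h1 := hlimit _ hmem
      simp only [WithLp.toLp_fst, WithLp.toLp_snd, add_sub_cancel_left, PiLp.add_apply,
        EuclideanSpace.inner_single_right, ← sub_sub, mul_sub (lamb _) (_ - _) _,
        Finset.sum_sub_distrib, PiLp.single_apply, mul_ite, mul_zero, Finset.sum_ite_eq',
        Finset.mem_univ, if_true] at h1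
      simp at h1
      nlinarith
    have h1 := hdir δ (by linarith)
    have h2 := hdir (-δ) le_rfl
    nlinarith
  have hmin : (0 : Vec n) ∈ realSubdiff (L + ((fun x => μb * l x) + fun x => ∑ i, lamb i * P i x))
      zb.fst := by
    rw [mem_realSubdiff]
    intro x
    have h1 := hlimit (WithLp.toLp 2 (x, zb.snd)) hσ
    simp only [WithLp.toLp_fst, WithLp.toLp_snd, sub_self, inner_zero_right, add_zero,
      mul_sub (lamb _) _ _, Finset.sum_sub_distrib] at h1
    simp only [Pi.add_apply, inner_zero_left, add_zero]
    linarith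
  have hcvP : ConvexOn ℝ univ (fun x => ∑ i, lamb i * P i x) :=
    convexOn_sum_const_mul Finset.univ hP hlamb
  have hcvl : ConvexOn ℝ univ (fun x => μb * l x) := hl.smul hμb
  refine ⟨hσ, hv.ge, hfeas, μb, WithLp.toLp 2 lamb, hμb, hlamb, ?_, ?_, hcompl⟩
  · rw [add_assoc]
    exact (realSubdiff_add_subset hL (hcvl.add hcvP) zb.fst).trans (add_subset_add le_rfl
      ((realSubdiff_add_subset hcvl hcvP zb.fst).trans (add_subset_add
        (realSubdiff_const_mul_subset hl hμb zb.fst)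
        (realSubdiff_sum_subset Finset.univ hP hlamb zb.fst)))) hmin
  -- `hlb` says `-γb ∈ ∂v`; since `λ = μb γb`, the normal vector can be taken to be 0.
  · refine ⟨(-μb) • (-γb), ⟨-γb, ⟨?_, ?_, fun r' => ?_⟩, rfl⟩, 0, ⟨hσ, by simp⟩, ?_⟩
    · rw [hv]; exact EReal.coe_ne_top _
    · rw [hv]; exact EReal.coe_ne_bot _
    · refine le_iInf₂ fun y hy => ?_
      rw [hv, ← EReal.coe_add, EReal.coe_le_coe_iff, inner_neg_left]
      linarith [hlb r' y hy]
    · ext i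
      simp [hlamγ i]

end IsConstantPenaltyRun

end Stationary

end

end ValueFunctionDCA

theorem mainTheorem4 {n J : ℕ}
    (L l : Vec n → ℝ) (P : Fin J → Vec n → ℝ)
    (hL : ConvexOn ℝ Set.univ L) (hl : ConvexOn ℝ Set.univ l)
    (hP : ∀ i, ConvexOn ℝ Set.univ (P i)) (hP0 : ∀ i x, 0 ≤ P i x)
    (hLL : ∀ r : Vec J, (∀ i, 0 < r i) →
      (feasible P r).Nonempty ∧ BddBelow (l '' feasible P r))
    (ρ c d : ℝ) (hρ : 0 < ρ) (hc : 0 < c) (hd : 0 < d)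
    (z : ℕ → Pt n J) (xt : ℕ → Vec n) (γ : ℕ → Vec J) (α : ℕ → ℝ)
    (hrun : IsVFiDCARun L l P ρ c d z xt γ α)
    (hLbdd : BddBelow (Set.range L))
    (hz : Bornology.IsBounded (Set.range z)) (hα : Bornology.IsBounded (Set.range α))
    (hKL : ∀ a : ℝ, (∀ᶠ k in Filter.atTop, α k = a) → IsKLFunction (merit L l P ρ a))
    (hδ : ∃ δ : ℝ, 0 < δ ∧ ∀ k i, δ ≤ (z k).snd i) :
    ∃ zbar : Pt n J, Filter.Tendsto z Filter.atTop (nhds zbar) ∧ IsKKTStationary L l P zbar := by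
  obtain ⟨δ, hδ0, hδ⟩ := hδ
  obtain ⟨K, a, ha, hK⟩ := hrun.exists_penalty_eq hd hα
  -- Discarding the first `K` iterates changes neither the limit nor its stationarity.
  have h := hrun.isConstantPenaltyRun hρ.le hd hK
  have hz' : Bornology.IsBounded (range fun k => z (k + K)) :=
    hz.subset (range_comp_subset_range (fun k => k + K) z)
  have hγ := h.isBounded_range_multiplier hLL hz' hδ0 fun k i => hδ (k + K) i
  obtain ⟨zb, hzb⟩ := h.exists_tendsto hL hl hP hLbdd hρ ha.le hc hz' hγ
    (hKL a (eventually_atTop.2 ⟨K, hK⟩))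
  exact ⟨zb, (tendsto_add_atTop_iff_nat K).1 hzb,
    h.isKKTStationary_of_tendsto hL hl hP ha.le hc hγ hδ0 (fun k i => hδ (k + K) i) hzb⟩
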